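/- Let $n\ge 2$ and let $J_1,J_n,m,b>0$, $\ell,\mathcal G\in\mathbb R$. The $n$-dimensional rubber Routh sphere is the nonholonomic system on $Q=\{(R,x)\in \mathrm{SO}(n)\times\mathbb R^n : x_n=b\}$ with Lagrangian $$L=\tfrac12(\mathbb I\Omega,\Omega)_\kappa+\tfrac m2\|R^{-1}\dot x+\ell\,\Omega E_n\|^2-m\mathcal G\ell\gamma_n ,\qquad \Omega=R^{-1}\dot R,\quad \gamma=R^{-1}e_n,$$ where $E_n=e_n=(0,\dots,0,1)^t$, $\mathbb I\Omega=\mathbb J\Omega+\Omega\mathbb J$, $\mathbb J=\mathrm{diag}(J_1,\dots,J_1,J_n)$, $(\xi,\eta)_\kappa=-\frac12\mathrm{tr}(\xi\eta)$, and with the constraints $\dot x=b\,\omega e_n$ and $\omega_{ij}=0$ for $1\le i,j\le n-1$, where $\omega=\dot RR^{-1}$; these define a distribution $D$ on $Q$, and the motions are the curves in $Q$ that satisfy the constraints and the Lagrange–d'Alembert principle. The map $\pi(R,x)=\gamma$ is the orbit projection of the symmetry group $\mathrm{SE}(n-1)$ onto the shape space $\mathrm S^{n-1}$. Let $\mathrm{hor}_q(v)\in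 D_q$ be the horizontal lift of $v\in T_{\pi(q)}\mathrm S^{n-1}$, $\langle\!\langle\cdot,\cdot\rangle\!\rangle$ the kinetic energy metric, $\langle\!\langle v,w\rangle\!\rangle^S=\langle\!\langle \mathrm{hor}\,v,\mathrm{hor}\,w\rangle\!\rangle$, $\mathcal L(\gamma,\dot\gamma)=L(\mathrm{hor}(\dot\gamma))$ the reduced Lagrangian, and $\mathcal T(Y,Z)=T\pi(\mathcal P[\mathrm{hor}\,Y,\mathrm{hor}\,Z])-[Y,Z]$ the gyroscopic tensor on $\mathrm S^{n-1}$, where $\mathcal P$ is the orthogonal projection onto $D$. The reduced motions are the projections $\gamma(t)=\pi(q(t))$ of the motions, and the reduced equations of motion read $\frac{d}{dt}\frac{\partial\mathcal L}{\partial\dot\gamma}-\frac{\partial\mathcal L}{\partial\gamma}=-\langle\!\langle\mathcal T(\cdot,\dot\gamma),\dot\gamma\rangle\!\rangle^S$ on $T\mathrm S^{n-1}$. For $1\le i,j\le n-1$ put $$F_{ij}=\sqrt{2J_1+(J_n-J_1)\gamma_n^2+m(b+\ell\gamma_n)^2}\;\Omega_{ij},$$ which is regarded as a function on $T\mathrm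 S^{n-1}$ through $\Omega=\gamma\wedge\dot\gamma:=\gamma\dot\gamma^t-\dot\gamma\gamma^t$. Then: 1. Every $F_{ij}$ is a first integral of the reduced motion: it is constant along every reduced motion and along every solution of the reduced equations of motion; with $\Omega=R^{-1}\dot R$ it is constant along every motion of the sphere. 2. The $F_{ij}$ are the components of the rescaled momentum map of the action of $\mathrm{SO}(n-1)$ on $\mathrm S^{n-1}$ by $\tilde a\cdot\gamma=\mathrm{diag}(\tilde a,1)\gamma$. Precisely, with $\phi(\gamma)=-\frac12\ln\left(2J_1+(J_n-J_1)\gamma_n^2+m(b+\ell\gamma_n)^2\right)$: the system is $\phi$-simple, i.e. $\mathcal T(Y,Z)=Z[\phi]Y-Y[\phi]Z$ for all vector fields $Y,Z$ on $\mathrm S^{n-1}$; the action leaves $\phi$ and $\mathcal L$ invariant; and $\mathcal J(\gamma,\dot\gamma)(\xi)=e^{\phi(\gamma)}\langle\!\langle\dot\gamma,\xi_S(\gamma)\rangle\!\rangle^S$, with $\xi_S$ the infinitesimal generator of $\xi\in\mathfrak{so}(n-1)$, satisfies $\mathcal J(\gamma,\dot\gamma)(E_i\wedge E_j)=-F_{ij}(\gamma,\dot\gamma)$.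 -/

import Mathlib

open Matrix

/-!  Index conventions: `n = d + 1`, the coordinates of `ℝⁿ` are indexed by `Fin (d + 1)`, the vertical
(last) index is `Fin.last d`, and the horizontal indices `1, …, n - 1` are `Fin.castSucc i` for
`i : Fin d`.  The space `Fin (d + 1) → ℝ` is used with its dot product `⬝ᵥ`. -/

/-- The physical parameters of the axisymmetric sphere: the entries `J₁, Jₙ` of the mass tensor
`diag (J₁, …, J₁, Jₙ)`, the mass `m`, the radius `b`, the distance `ℓ` from the centre of mass to the
geometric centre, and the gravitational constant `𝒢`. -/
structure RouthSphere where
  J₁ : ℝ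
  Jₙ : ℝ
  m : ℝ
  b : ℝ
  ℓ : ℝ
  𝒢 : ℝ

namespace RouthSphere

/-- Linear space containing `Q = SO(n) × ℝⁿ⁻¹` (and each of its tangent spaces): pairs
`(R, x)`, respectively `(Ṙ, ẋ)`. -/
abbrev Ambient (d : ℕ) : Type := Matrix (Fin (d + 1)) (Fin (d + 1)) ℝ × (Fin (d + 1) → ℝ)

/-- The vector `e_n` (also `E_n`). -/
def en (d : ℕ) : Fin (d + 1) → ℝ := Pi.single (Fin.last d) 1

/-- `y ∧ z = y zᵗ - z yᵗ`. -/
def wedge {k : ℕ} (y z : Fin k → ℝ) : Matrix (Fin k) (Fin k) ℝ := vecMulVec y z - vecMulVec z y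

/-- `(ξ, η)_κ = - tr (ξ η) / 2`. -/
noncomputable def killing {k : ℕ} (ξ η : Matrix (Fin k) (Fin k) ℝ) : ℝ := -(1 / 2) * (ξ * η).trace

/-- The mass tensor `𝕁 = diag (J₁, …, J₁, Jₙ)`. -/
def massTensor {d : ℕ} (B : RouthSphere) : Matrix (Fin (d + 1)) (Fin (d + 1)) ℝ :=
  Matrix.diagonal fun i => if i = Fin.last d then B.Jₙ else B.J₁

/-- The inertia tensor `𝕀 Ω = 𝕁 Ω + Ω 𝕁`. -/
def inertia {d : ℕ} (B : RouthSphere) (Ω : Matrix (Fin (d + 1)) (Fin (d + 1)) ℝ) :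
    Matrix (Fin (d + 1)) (Fin (d + 1)) ℝ :=
  B.massTensor * Ω + Ω * B.massTensor

/-! ### The nonholonomic system -/

/-- The configuration space `Q = SO(n) × ℝⁿ⁻¹`, embedded in `SO(n) × ℝⁿ` by `x_n = b`. -/
def configSpace (d : ℕ) (B : RouthSphere) : Set (Ambient d) :=
  {q | q.1 ∈ Matrix.specialOrthogonalGroup (Fin (d + 1)) ℝ ∧ q.2 (Fin.last d) = B.b}

/-- The Poisson vector `γ = R⁻¹ e_n` (with `R⁻¹ = Rᵗ`), that is, the orbit projection `π : Q → Sⁿ⁻¹`. -/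
def poisson {d : ℕ} (q : Ambient d) : Fin (d + 1) → ℝ := q.1ᵀ *ᵥ en d

/-- The tangent map `Tπ` of `poisson`; it only depends on the `Ṙ` part of the tangent vector. -/
def tangentPoisson {d : ℕ} (V : Ambient d) : Fin (d + 1) → ℝ := V.1ᵀ *ᵥ en d

/-- The body angular velocity `Ω = R⁻¹ Ṙ`. -/
def bodyVelocity {d : ℕ} (q V : Ambient d) : Matrix (Fin (d + 1)) (Fin (d + 1)) ℝ := q.1ᵀ * V.1

/-- The space angular velocity `ω = Ṙ R⁻¹`. -/
def spaceVelocity {d : ℕ} (q V : Ambient d) : Matrix (Fin (d + 1)) (Fin (d + 1)) ℝ := V.1 * q.1ᵀ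

/-- The fibre `D_q` of the constraint distribution: tangent vectors `(Ṙ, ẋ)` to `Q` at `q` with
`ẋ = b ω e_n` (rolling without slipping) and `ω_ij = 0` for `1 ≤ i, j ≤ n - 1` (no spinning). -/
def distribution {d : ℕ} (B : RouthSphere) (q : Ambient d) : Set (Ambient d) :=
  {V | ((bodyVelocity q V)ᵀ = -bodyVelocity q V ∧ V.2 (Fin.last d) = 0) ∧
    V.2 = B.b • (spaceVelocity q V *ᵥ en d) ∧
    ∀ i j : Fin d, spaceVelocity q V i.castSucc j.castSucc = 0}

/-- The kinetic energy metric `⟪V, W⟫_q`. -/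
noncomputable def metric {d : ℕ} (B : RouthSphere) (q V W : Ambient d) : ℝ :=
  killing (B.inertia (bodyVelocity q V)) (bodyVelocity q W) +
    B.m * ((q.1ᵀ *ᵥ V.2 + B.ℓ • (bodyVelocity q V *ᵥ en d)) ⬝ᵥ
      (q.1ᵀ *ᵥ W.2 + B.ℓ • (bodyVelocity q W *ᵥ en d)))

/-- The Lagrangian `L = ½ (𝕀 Ω, Ω)_κ + (m/2) ‖R⁻¹ ẋ + ℓ Ω E_n‖² - m 𝒢 ℓ γ_n`. -/
noncomputable def lagrangian {d : ℕ} (B : RouthSphere) (q V : Ambient d) : ℝ :=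
  (1 / 2) * B.metric q V V - B.m * B.𝒢 * B.ℓ * poisson q (Fin.last d)

/-- The Euler–Lagrange expression `(d/dt (∂L/∂q̇) - ∂L/∂q) · δ` of a function `L (q, q̇)` on a linear
space, along the curve `c`, at time `t`, in the fixed direction `δ`.  If `c` lies in a submanifold and
`δ` is tangent to it at `c t`, the value only depends on the restriction of `L` to the tangent bundle of
the submanifold, and it is the intrinsic Euler–Lagrange covector of that restriction. -/
noncomputable def eulerLagrange {V : Type*} [AddCommGroup V] [Module ℝ V] [TopologicalSpace V]
    (L : V → V → ℝ) (c : ℝ → V) (t : ℝ) (δ : V) : ℝ :=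
  deriv (fun s => deriv (fun ε : ℝ => L (c s) (deriv c s + ε • δ)) 0) t -
    deriv (fun ε : ℝ => L (c t + ε • δ) (deriv c t)) 0

section

attribute [local instance] Matrix.normedAddCommGroup Matrix.normedSpace

/-- `c` is a motion of the `n`-dimensional rubber Routh sphere on the time set `I`: a curve in `Q` that
satisfies the constraints and the Lagrange–d'Alembert principle. -/
structure IsMotion {d : ℕ} (B : RouthSphere) (I : Set ℝ) (c : ℝ → Ambient d) : Prop where
  contDiffOn : ContDiffOn ℝ 2 c I
  mem_configSpace : ∀ t ∈ I, c t ∈ configSpace d B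
  constraint : ∀ t ∈ I, deriv c t ∈ B.distribution (c t)
  lagrange_dAlembert : ∀ t ∈ I, ∀ δ ∈ B.distribution (c t), eulerLagrange B.lagrangian c t δ = 0

end

/-! ### Reduction to the shape space `Sⁿ⁻¹` -/

/-- The horizontal lift at `q` of `v ∈ T_γ Sⁿ⁻¹`, `γ = π q`; see `mem_distribution_iff_eq_hor`. -/
def hor {d : ℕ} (B : RouthSphere) (q : Ambient d) (v : Fin (d + 1) → ℝ) : Ambient d :=
  (q.1 * wedge (poisson q) v, -B.b • (q.1 *ᵥ v))

/-- The metric `⟪v, w⟫^S_γ` on the shape space; see `metricS_poisson`. -/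
noncomputable def metricS {d : ℕ} (B : RouthSphere) (γ v w : Fin (d + 1) → ℝ) : ℝ :=
  killing (B.inertia (wedge γ v)) (wedge γ w) +
    B.m * ((-B.b • v + B.ℓ • (wedge γ v *ᵥ en d)) ⬝ᵥ (-B.b • w + B.ℓ • (wedge γ w *ᵥ en d)))

/-- The reduced Lagrangian on `T Sⁿ⁻¹`; see `reducedLagrangian_poisson`. -/
noncomputable def reducedLagrangian {d : ℕ} (B : RouthSphere) (γ v : Fin (d + 1) → ℝ) : ℝ :=
  (1 / 2) * B.metricS γ v v - B.m * B.𝒢 * B.ℓ * γ (Fin.last d)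

/-- A smooth vector field on `Sⁿ⁻¹`, given through a smooth extension to `ℝⁿ`. -/
structure IsSphereField {d : ℕ} (Y : (Fin (d + 1) → ℝ) → (Fin (d + 1) → ℝ)) : Prop where
  contDiff : ContDiff ℝ (⊤ : ℕ∞) Y
  tangent : ∀ s, s ⬝ᵥ s = 1 → s ⬝ᵥ Y s = 0

/-- The horizontal lift of a vector field on the shape space. -/
def horField {d : ℕ} (B : RouthSphere) (Y : (Fin (d + 1) → ℝ) → (Fin (d + 1) → ℝ))
    (q : Ambient d) : Ambient d :=
  B.hor q (Y (poisson q))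

/-- `p` is the orthogonal projection `𝒫 X` of the tangent vector `X` at `q` onto `D_q`, with respect to
the kinetic energy metric. -/
def IsOrthProj {d : ℕ} (B : RouthSphere) (q X p : Ambient d) : Prop :=
  p ∈ B.distribution q ∧ ∀ δ ∈ B.distribution q, B.metric q (X - p) δ = 0

section

attribute [local instance] Matrix.normedAddCommGroup Matrix.normedSpace

/-- `u = 𝒯 (Y, Z) (s)`, where `𝒯` is the gyroscopic tensor
`𝒯 (Y, Z) (s) = T_qπ (𝒫 [hor Y, hor Z] (q)) - [Y, Z] (s)`, `q ∈ π⁻¹ (s)`.  The brackets are computed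
with extensions of the vector fields to the ambient linear spaces. -/
def IsGyroscopic {d : ℕ} (B : RouthSphere) (Y Z : (Fin (d + 1) → ℝ) → (Fin (d + 1) → ℝ))
    (s u : Fin (d + 1) → ℝ) : Prop :=
  ∀ q ∈ configSpace d B, poisson q = s →
    ∃ p, B.IsOrthProj q (VectorField.lieBracket ℝ (B.horField Y) (B.horField Z) q) p ∧
      u = tangentPoisson p - VectorField.lieBracket ℝ Y Z s

end

/-- `γ` solves the reduced equations of motion on the time set `I`:
`d/dt (∂𝓛/∂ṡ) - ∂𝓛/∂s = - ⟪𝒯 (·, ṡ), ṡ⟫^S` on `T Sⁿ⁻¹`, the coordinate-free form of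
`d/dt (∂𝓛/∂ṡⁱ) - ∂𝓛/∂sⁱ = - ∑_{j,k} C_ij^k ṡʲ ∂𝓛/∂ṡᵏ`. -/
structure IsReducedSolution {d : ℕ} (B : RouthSphere) (I : Set ℝ) (γ : ℝ → Fin (d + 1) → ℝ) :
    Prop where
  contDiffOn : ContDiffOn ℝ 2 γ I
  mem_sphere : ∀ t ∈ I, γ t ⬝ᵥ γ t = 1
  equation : ∀ t ∈ I, ∀ Y Z, IsSphereField Y → IsSphereField Z → Z (γ t) = deriv γ t →
    ∀ u, B.IsGyroscopic Y Z (γ t) u →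
      eulerLagrange B.reducedLagrangian γ t (Y (γ t)) = -B.metricS (γ t) u (deriv γ t)

/-- `γ` is a reduced motion: the projection to the shape space of a motion of the sphere. -/
def IsReducedMotion {d : ℕ} (B : RouthSphere) (I : Set ℝ) (γ : ℝ → Fin (d + 1) → ℝ) : Prop :=
  ∃ c : ℝ → Ambient d, B.IsMotion I c ∧ ∀ t ∈ I, γ t = poisson (c t)

/-- The function `2 J₁ + (Jₙ - J₁) γ_n² + m (b + ℓ γ_n)²`. -/
def conformal {d : ℕ} (B : RouthSphere) (γ : Fin (d + 1) → ℝ) : ℝ :=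
  2 * B.J₁ + (B.Jₙ - B.J₁) * γ (Fin.last d) ^ 2 + B.m * (B.b + B.ℓ * γ (Fin.last d)) ^ 2

/-- `φ (γ) = - ½ ln (2 J₁ + (Jₙ - J₁) γ_n² + m (b + ℓ γ_n)²)`. -/
noncomputable def phi {d : ℕ} (B : RouthSphere) (γ : Fin (d + 1) → ℝ) : ℝ :=
  -(1 / 2) * Real.log (B.conformal γ)

/-- The system is `f`-simple, `f` a function on `Sⁿ⁻¹` given through an extension to `ℝⁿ`:
`𝒯 (Y, Z) = Z[f] Y - Y[f] Z` for all vector fields `Y, Z` on `Sⁿ⁻¹`. -/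
def IsSimple {d : ℕ} (B : RouthSphere) (f : (Fin (d + 1) → ℝ) → ℝ) : Prop :=
  ∀ Y Z, IsSphereField Y → IsSphereField Z → ∀ s, s ⬝ᵥ s = 1 →
    B.IsGyroscopic Y Z s (fderiv ℝ f s (Z s) • Y s - fderiv ℝ f s (Y s) • Z s)

/-! ### The `SO(n-1)`-action and the rescaled momentum map -/

/-- The block matrix `a = diag (ã, 1)`. -/
def embed {d : ℕ} (a : Matrix (Fin d) (Fin d) ℝ) : Matrix (Fin (d + 1)) (Fin (d + 1)) ℝ :=
  Matrix.of fun i j =>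
    Fin.lastCases (motive := fun _ => ℝ)
      (Fin.lastCases (motive := fun _ => ℝ) 1 (fun _ => 0) j)
      (fun i' => Fin.lastCases (motive := fun _ => ℝ) 0 (fun j' => a i' j') j) i

/-- The infinitesimal generator `ξ_S (γ) = d/dt|_{t=0} exp (t ξ) · γ` of `ξ ∈ 𝔰𝔬(n-1)`, for the action
`ã · γ = diag (ã, 1) γ` of `SO(n-1)` on `Sⁿ⁻¹`. -/
noncomputable def generator {d : ℕ} (ξ : Matrix (Fin d) (Fin d) ℝ) (γ : Fin (d + 1) → ℝ) :
    Fin (d + 1) → ℝ :=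
  deriv (fun t : ℝ => embed (NormedSpace.exp (t • ξ)) *ᵥ γ) 0

/-- The rescaled tangent bundle momentum map `𝒥 (γ, v) (ξ) = exp (φ (γ)) ⟪v, ξ_S (γ)⟫^S`. -/
noncomputable def momentumMap {d : ℕ} (B : RouthSphere) (γ v : Fin (d + 1) → ℝ)
    (ξ : Matrix (Fin d) (Fin d) ℝ) : ℝ :=
  Real.exp (B.phi γ) * B.metricS γ v (generator ξ γ)

/-- `F_ij = √(2 J₁ + (Jₙ - J₁) γ_n² + m (b + ℓ γ_n)²) Ω_ij`, `1 ≤ i, j ≤ n - 1`, as a function of the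
Poisson vector and the body angular velocity.  As a function on `T Sⁿ⁻¹`, it is taken at `Ω = γ ∧ γ̇`. -/
noncomputable def firstIntegral {d : ℕ} (B : RouthSphere) (i j : Fin d) (γ : Fin (d + 1) → ℝ)
    (Ω : Matrix (Fin (d + 1)) (Fin (d + 1)) ℝ) : ℝ :=
  Real.sqrt (B.conformal γ) * Ω i.castSucc j.castSucc

/-! ### The formulas for the reduced objects agree with their definitions -/

lemma transpose_mul_self_of_mem {d : ℕ} {B : RouthSphere} {q : Ambient d} (hq : q ∈ configSpace d B) :
    q.1ᵀ * q.1 = 1 := by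
  have h := (Matrix.mem_specialOrthogonalGroup_iff.1 hq.1).1
  simpa [Matrix.star_eq_conjTranspose] using (Matrix.mem_orthogonalGroup_iff' (Fin (d + 1)) ℝ).1 h

lemma mul_transpose_self_of_mem {d : ℕ} {B : RouthSphere} {q : Ambient d} (hq : q ∈ configSpace d B) :
    q.1 * q.1ᵀ = 1 :=
  mul_eq_one_comm.1 (transpose_mul_self_of_mem hq)

lemma bodyVelocity_hor {d : ℕ} {B : RouthSphere} {q : Ambient d} (hq : q ∈ configSpace d B)
    (v : Fin (d + 1) → ℝ) : bodyVelocity q (B.hor q v) = wedge (poisson q) v := by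
  simp [bodyVelocity, hor, ← Matrix.mul_assoc, transpose_mul_self_of_mem hq]

/-- The metric on the shape space is `⟪v, w⟫^S = ⟪hor v, hor w⟫`. -/
theorem metricS_poisson {d : ℕ} {B : RouthSphere} {q : Ambient d} (hq : q ∈ configSpace d B)
    (v w : Fin (d + 1) → ℝ) : B.metricS (poisson q) v w = B.metric q (B.hor q v) (B.hor q w) := by
  have h : ∀ v, q.1ᵀ *ᵥ (B.hor q v).2 = -B.b • v := fun v => by
    simp [hor, Matrix.mulVec_smul, Matrix.mulVec_neg, transpose_mul_self_of_mem hq]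
  simp only [metric, metricS, bodyVelocity_hor hq, h]

/-- The reduced Lagrangian is `𝓛 (γ, v) = L (hor v)`. -/
theorem reducedLagrangian_poisson {d : ℕ} {B : RouthSphere} {q : Ambient d}
    (hq : q ∈ configSpace d B) (v : Fin (d + 1) → ℝ) :
    B.reducedLagrangian (poisson q) v = B.lagrangian q (B.hor q v) := by
  simp only [reducedLagrangian, lagrangian, metricS_poisson hq]

lemma wedge_mulVec {k : ℕ} (y z w : Fin k → ℝ) :
    wedge y z *ᵥ w = (z ⬝ᵥ w) • y - (y ⬝ᵥ w) • z := by
  simp [wedge, Matrix.sub_mulVec, Matrix.vecMulVec_mulVec]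

lemma wedge_transpose {k : ℕ} (y z : Fin k → ℝ) : (wedge y z)ᵀ = -wedge y z := by
  simp [wedge, Matrix.transpose_sub, Matrix.transpose_vecMulVec]

lemma mul_wedge_mul_transpose {k : ℕ} (R : Matrix (Fin k) (Fin k) ℝ) (y z : Fin k → ℝ) :
    R * wedge y z * Rᵀ = wedge (R *ᵥ y) (R *ᵥ z) := by
  simp [wedge, Matrix.mul_sub, Matrix.sub_mul, Matrix.mul_vecMulVec, Matrix.vecMulVec_mul,
    Matrix.vecMul_transpose]

/-- `hor q v` is the unique vector in `D_q` that `Tπ` maps to `v`. -/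
theorem mem_distribution_iff_eq_hor {d : ℕ} {B : RouthSphere} {q : Ambient d}
    (hq : q ∈ configSpace d B) {v : Fin (d + 1) → ℝ} (hv : poisson q ⬝ᵥ v = 0) (V : Ambient d) :
    (V ∈ B.distribution q ∧ tangentPoisson V = v) ↔ V = B.hor q v := by
  have h1 := transpose_mul_self_of_mem hq
  have h2 := mul_transpose_self_of_mem hq
  have hγ : q.1 *ᵥ poisson q = en d := by simp [poisson, h2]
  have hee : en d ⬝ᵥ en d = 1 := by simp [en]
  have hγγ : poisson q ⬝ᵥ poisson q = 1 := by
    rw [← hee]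
    nth_rw 1 [poisson]
    rw [Matrix.mulVec_transpose, ← Matrix.dotProduct_mulVec, hγ]
  have hRv : en d ⬝ᵥ (q.1 *ᵥ v) = 0 := by
    rw [Matrix.dotProduct_mulVec, ← Matrix.mulVec_transpose]; exact hv
  have hs : spaceVelocity q (B.hor q v) = wedge (en d) (q.1 *ᵥ v) := by
    rw [← hγ, ← mul_wedge_mul_transpose]; rfl
  constructor
  · rintro ⟨⟨⟨hskew, hlast⟩, hroll, hspin⟩, hT⟩
    set ω := spaceVelocity q V with hω
    have hωΩ : ω = q.1 * bodyVelocity q V * q.1ᵀ := by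
      simp [hω, spaceVelocity, bodyVelocity, ← Matrix.mul_assoc, h2]
    have hωs : ωᵀ = -ω := by
      rw [hωΩ, Matrix.transpose_mul, Matrix.transpose_mul, hskew]
      simp [Matrix.mul_assoc]
    have hωe : q.1 *ᵥ v = -(ω *ᵥ en d) := by
      rw [← hT, tangentPoisson, Matrix.mulVec_mulVec, ← Matrix.neg_mulVec, ← hωs]
      simp [hω, spaceVelocity]
    have hwedge : ω = wedge (en d) (q.1 *ᵥ v) := by
      have hsij : ∀ i j, ω j i = -ω i j := fun i j => by
        have := congrFun (congrFun hωs i) j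
        simpa using this
      rw [hωe]
      ext i j
      have hc : ∀ k, (ω *ᵥ en d) k = ω k (Fin.last d) := fun k => by simp [en]
      simp only [wedge, Matrix.sub_apply, Matrix.vecMulVec_apply, Pi.neg_apply, hc]
      refine Fin.lastCases ?_ (fun i' => ?_) i <;> refine Fin.lastCases ?_ (fun j' => ?_) j
      · have := hsij (Fin.last d) (Fin.last d)
        simp [en]; linarith
      · have := hsij (Fin.last d) j'.castSucc
        simp [en, this]
      · simp [en]
      · simp [en, hspin i' j']
    have hV1 : V.1 = ω * q.1 := by
      simp [hω, spaceVelocity, Matrix.mul_assoc, h1]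
    ext1
    · rw [hV1, hwedge, ← hs]
      simp [spaceVelocity, Matrix.mul_assoc, h1]
    · rw [hroll]
      simp [hor, hωe]
  · rintro rfl
    refine ⟨⟨⟨?_, ?_⟩, ?_, ?_⟩, ?_⟩
    · rw [bodyVelocity_hor hq, wedge_transpose]
    · have : (q.1 *ᵥ v) (Fin.last d) = 0 := by simpa [en] using hRv
      simp [hor, this]
    · rw [hs, wedge_mulVec, hee, dotProduct_comm, hRv]
      simp [hor]
    · intro i j
      rw [hs]
      simp [wedge, Matrix.vecMulVec_apply, en]
    · simp only [tangentPoisson, hor, Matrix.transpose_mul, ← Matrix.mulVec_mulVec]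
      change (wedge (poisson q) v)ᵀ *ᵥ poisson q = v
      rw [wedge_transpose, Matrix.neg_mulVec, wedge_mulVec, hγγ, dotProduct_comm, hv]
      simp

end RouthSphere

/-! Write `f` for `conformal` and `h` for `halfDeriv`, so that `ḟ = 2 h γ̇_n` along a curve. Call
`δ` horizontal if `γ · δ = 0` and `δ_n = 0`. The conservation laws come from one scalar equation, `f
γ̈ · δ + h γ̇_n γ̇ · δ = 0` for horizontal `δ`. With `δ = rotation i j γ` it reads `f Ω̇_ij + ½ ḟ
Ω_ij = 0`, that is, `d/dt (√f Ω_ij) = 0` (`firstIntegral_eq_of_equation`). Gravity drops out because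
`δ_n = 0`.

The equation is obtained in two ways. On `Q`, the constraints force `ċ = hor γ̇`, and the
Lagrange–d'Alembert principle is evaluated on `hor δ` (`IsMotion.eulerLagrange_lagrangian`). On the
sphere, the Euler–Lagrange expression is `f γ̈ · δ + 2 h γ̇_n γ̇ · δ`, and the gyroscopic force
cancels half of the second term (`IsReducedSolution.equation_horizontal`).

The gyroscopic force is known from `φ`-simplicity. The bracket `[hor Y, hor Z]` exceeds `hor [Y, Z]`
by the pure rotation `R (Y ∧ Z)` (`lieBracket_horField`). Its inner product with `hor δ` is `-h (Z_n
Y - Y_n Z) · δ`, while the shape metric on tangent vectors is `f v · w` plus a multiple of `v_n w_n`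
(`metricS_tangent`). Since `Z_n Y - Y_n Z` is horizontal, the projection amounts to division by `f`,
and `-h / f` is the derivative of `φ` with respect to `γ_n`. The same form of the metric yields the
invariance of the Lagrangian and, as `e^φ f = √f`, the momentum map. -/

namespace RouthSphere

variable {d : ℕ}

/-! ### The kinetic energy form in body coordinates -/

/-- The bilinear form `(𝕀 Ω, Δ)_κ + m (y + ℓ Ω E_n) · (η + ℓ Δ E_n)` that defines the kinetic energy in
terms of the body velocities `Ω, Δ` and `y, η`. -/
noncomputable def bodyForm (B : RouthSphere) (Ω : Matrix (Fin (d + 1)) (Fin (d + 1)) ℝ)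
    (y : Fin (d + 1) → ℝ) (Δ : Matrix (Fin (d + 1)) (Fin (d + 1)) ℝ) (η : Fin (d + 1) → ℝ) : ℝ :=
  killing (B.inertia Ω) Δ + B.m * ((y + B.ℓ • (Ω *ᵥ en d)) ⬝ᵥ (η + B.ℓ • (Δ *ᵥ en d)))

lemma metric_eq_bodyForm (B : RouthSphere) (q V W : Ambient d) :
    B.metric q V W = B.bodyForm (q.1ᵀ * V.1) (q.1ᵀ *ᵥ V.2) (q.1ᵀ * W.1) (q.1ᵀ *ᵥ W.2) := rfl

lemma metricS_eq_bodyForm (B : RouthSphere) (γ v w : Fin (d + 1) → ℝ) :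
    B.metricS γ v w = B.bodyForm (wedge γ v) (-B.b • v) (wedge γ w) (-B.b • w) := rfl

lemma bodyForm_add_left (B : RouthSphere) (Ω Ω' Δ : Matrix (Fin (d + 1)) (Fin (d + 1)) ℝ)
    (y y' η : Fin (d + 1) → ℝ) :
    B.bodyForm (Ω + Ω') (y + y') Δ η = B.bodyForm Ω y Δ η + B.bodyForm Ω' y' Δ η := by
  simp only [bodyForm, killing, inertia, Matrix.mul_add, Matrix.add_mul, Matrix.trace_add,
    Matrix.add_mulVec, smul_add, add_dotProduct]
  ring

lemma bodyForm_comm (B : RouthSphere) (Ω Δ : Matrix (Fin (d + 1)) (Fin (d + 1)) ℝ)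
    (y η : Fin (d + 1) → ℝ) : B.bodyForm Ω y Δ η = B.bodyForm Δ η Ω y := by
  have h1 : (B.massTensor * Ω * Δ).trace = (Δ * B.massTensor * Ω).trace := by
    rw [Matrix.trace_mul_comm, Matrix.mul_assoc]
  have h2 : (Ω * B.massTensor * Δ).trace = (B.massTensor * Δ * Ω).trace := by
    rw [Matrix.mul_assoc, Matrix.trace_mul_comm]
  simp only [bodyForm, killing, inertia, Matrix.add_mul, Matrix.trace_add, h1, h2]
  rw [dotProduct_comm]
  ring

lemma bodyForm_sub_left (B : RouthSphere) (Ω Ω' Δ : Matrix (Fin (d + 1)) (Fin (d + 1)) ℝ)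
    (y y' η : Fin (d + 1) → ℝ) :
    B.bodyForm (Ω - Ω') (y - y') Δ η = B.bodyForm Ω y Δ η - B.bodyForm Ω' y' Δ η := by
  rw [eq_sub_iff_add_eq, ← bodyForm_add_left, sub_add_cancel, sub_add_cancel]

lemma bodyForm_sub_right (B : RouthSphere) (Ω Δ Δ' : Matrix (Fin (d + 1)) (Fin (d + 1)) ℝ)
    (y η η' : Fin (d + 1) → ℝ) :
    B.bodyForm Ω y (Δ - Δ') (η - η') = B.bodyForm Ω y Δ η - B.bodyForm Ω y Δ' η' := by
  simp only [bodyForm_comm B Ω, bodyForm_sub_left]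

lemma dotProduct_en (y : Fin (d + 1) → ℝ) : y ⬝ᵥ en d = y (Fin.last d) := by simp [en]

lemma en_dotProduct (y : Fin (d + 1) → ℝ) : en d ⬝ᵥ y = y (Fin.last d) := by simp [en]

lemma massTensor_eq (B : RouthSphere) :
    B.massTensor (d := d) = B.J₁ • 1 + (B.Jₙ - B.J₁) • vecMulVec (en d) (en d) := by
  ext i j
  by_cases hij : i = j
  · subst hij
    by_cases hi : i = Fin.last d <;> simp [massTensor, en, vecMulVec_apply, hi]
  · by_cases hi : i = Fin.last d
    · subst hi
      simp [massTensor, en, vecMulVec_apply, hij, Ne.symm hij]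
    · simp [massTensor, en, vecMulVec_apply, hij, hi]

lemma killing_wedge_wedge {k : ℕ} (y z p q : Fin k → ℝ) :
    killing (wedge y z) (wedge p q) = (y ⬝ᵥ p) * (z ⬝ᵥ q) - (y ⬝ᵥ q) * (z ⬝ᵥ p) := by
  simp only [killing, wedge, Matrix.mul_sub, Matrix.sub_mul, Matrix.vecMulVec_mul_vecMulVec,
    Matrix.trace_sub, Matrix.trace_vecMulVec, dotProduct_smul, smul_eq_mul]
  ring

/-- The mass tensor is a multiple of the identity plus a multiple of the rank-one matrix `e_n e_nᵗ`,
whose anticommutator with a skew matrix `M` is `(M e_n) ∧ e_n`. -/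
lemma inertia_wedge (B : RouthSphere) (y z : Fin (d + 1) → ℝ) :
    B.inertia (wedge y z) = (2 * B.J₁) • wedge y z +
      (B.Jₙ - B.J₁) • wedge (z (Fin.last d) • y - y (Fin.last d) • z) (en d) := by
  have h : vecMulVec (en d) (en d) * wedge y z + wedge y z * vecMulVec (en d) (en d) =
      wedge (z (Fin.last d) • y - y (Fin.last d) • z) (en d) := by
    ext i j
    simp only [wedge, Matrix.mul_sub, Matrix.sub_mul, Matrix.vecMulVec_mul_vecMulVec,
      dotProduct_en, en_dotProduct, Matrix.sub_apply, Matrix.add_apply,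
      vecMulVec_apply, Pi.sub_apply, Pi.smul_apply, smul_eq_mul]
    ring
  rw [inertia, massTensor_eq, ← h]
  simp only [Matrix.add_mul, Matrix.mul_add, Matrix.smul_mul, Matrix.mul_smul, Matrix.one_mul,
    Matrix.mul_one, smul_add, two_mul, add_smul]
  abel

/-- All inner products needed below are between wedge products, so this reduces them to polynomials
in dot products and last coordinates. -/
lemma bodyForm_wedge_wedge (B : RouthSphere) (y z p q r s : Fin (d + 1) → ℝ) :
    B.bodyForm (wedge y z) r (wedge p q) s =
      2 * B.J₁ * ((y ⬝ᵥ p) * (z ⬝ᵥ q) - (y ⬝ᵥ q) * (z ⬝ᵥ p)) +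
      (B.Jₙ - B.J₁) *
        ((z (Fin.last d) * (y ⬝ᵥ p) - y (Fin.last d) * (z ⬝ᵥ p)) * q (Fin.last d) -
          (z (Fin.last d) * (y ⬝ᵥ q) - y (Fin.last d) * (z ⬝ᵥ q)) * p (Fin.last d)) +
      B.m * ((r + B.ℓ • (z (Fin.last d) • y - y (Fin.last d) • z)) ⬝ᵥ
        (s + B.ℓ • (q (Fin.last d) • p - p (Fin.last d) • q))) := by
  have hk : ∀ (a c : ℝ) (M N P : Matrix (Fin (d + 1)) (Fin (d + 1)) ℝ),
      killing (a • M + c • N) P = a * killing M P + c * killing N P := fun a c M N P => by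
    simp only [killing, Matrix.add_mul, Matrix.smul_mul, Matrix.trace_add, Matrix.trace_smul,
      smul_eq_mul]
    ring
  simp only [bodyForm, inertia_wedge, hk, killing_wedge_wedge, wedge_mulVec, dotProduct_en,
    en_dotProduct, sub_dotProduct, smul_dotProduct, smul_eq_mul]

/-! ### The kinetic form on tangent vectors of the sphere -/

/-- `½ f'`, where `f = conformal` is regarded as a function of `γ_n`. -/
def halfDeriv (B : RouthSphere) (γ : Fin (d + 1) → ℝ) : ℝ :=
  (B.Jₙ - B.J₁) * γ (Fin.last d) + B.m * B.ℓ * (B.b + B.ℓ * γ (Fin.last d))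

lemma sq_last_le_one {γ : Fin (d + 1) → ℝ} (h : γ ⬝ᵥ γ = 1) : γ (Fin.last d) ^ 2 ≤ 1 := by
  rw [← h, dotProduct, sq]
  exact Finset.single_le_sum (f := fun i => γ i * γ i) (fun i _ => mul_self_nonneg (γ i))
    (Finset.mem_univ _)

/-- On the sphere `γ_n² ≤ 1`, and the function equals `J₁ + J₁ (1 - γ_n²) + Jₙ γ_n² + m (b + ℓ
γ_n)²`. -/
lemma conformal_pos {B : RouthSphere} (hJ₁ : 0 < B.J₁) (hJₙ : 0 < B.Jₙ) (hm : 0 < B.m)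
    {γ : Fin (d + 1) → ℝ} (h : γ ⬝ᵥ γ = 1) : 0 < B.conformal γ := by
  have h1 := sq_last_le_one h
  have h2 : 0 ≤ B.J₁ * (1 - γ (Fin.last d) ^ 2) := mul_nonneg hJ₁.le (by linarith)
  have h3 : 0 ≤ B.Jₙ * γ (Fin.last d) ^ 2 := by positivity
  have h4 : 0 ≤ B.m * (B.b + B.ℓ * γ (Fin.last d)) ^ 2 := by positivity
  unfold conformal
  linarith

/-- The shape metric on tangent vectors. -/
lemma metricS_tangent (B : RouthSphere) {γ v w : Fin (d + 1) → ℝ} (h : γ ⬝ᵥ γ = 1)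
    (hv : γ ⬝ᵥ v = 0) (hw : γ ⬝ᵥ w = 0) :
    B.metricS γ v w = B.conformal γ * (v ⬝ᵥ w) +
      (B.Jₙ - B.J₁ + B.m * B.ℓ ^ 2) * (v (Fin.last d) * w (Fin.last d)) := by
  simp only [metricS_eq_bodyForm, bodyForm_wedge_wedge, add_dotProduct, sub_dotProduct,
    dotProduct_add, dotProduct_sub, smul_dotProduct, dotProduct_smul, smul_eq_mul, h, hv, hw,
    dotProduct_comm v γ, conformal, neg_smul, neg_dotProduct, dotProduct_neg]
  ring

/-- The Lagrange–d'Alembert expression of the sphere in terms of `γ`, `v = γ̇`, `a = γ̈`. -/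
lemma bodyForm_add_bodyForm_horizontal (B : RouthSphere) {γ v a δ : Fin (d + 1) → ℝ}
    (h : γ ⬝ᵥ γ = 1) (hv : γ ⬝ᵥ v = 0) (hδ : γ ⬝ᵥ δ = 0) (hδn : δ (Fin.last d) = 0) :
    B.bodyForm (wedge v v + wedge γ a) (-B.b • a) (wedge γ δ) (-B.b • δ) +
        B.bodyForm (wedge γ v) (-B.b • v) (wedge v δ) 0 =
      B.conformal γ * (a ⬝ᵥ δ) + B.halfDeriv γ * v (Fin.last d) * (v ⬝ᵥ δ) := by
  have h0 : wedge v v + wedge γ a = wedge γ a := by simp [wedge]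
  simp only [h0, bodyForm_wedge_wedge, add_dotProduct, sub_dotProduct,
    dotProduct_add, dotProduct_sub, smul_dotProduct, dotProduct_smul, smul_eq_mul, h, hv, hδ, hδn,
    conformal, halfDeriv, neg_smul, neg_dotProduct, dotProduct_neg,
    dotProduct_zero]
  ring

/-- The derivative of the shape metric with respect to the base point. -/
lemma bodyForm_wedge_horizontal (B : RouthSphere) {γ v δ : Fin (d + 1) → ℝ}
    (hv : γ ⬝ᵥ v = 0) (hδ : γ ⬝ᵥ δ = 0) (hδn : δ (Fin.last d) = 0) :
    B.bodyForm (wedge γ v) (-B.b • v) (wedge δ v) 0 =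
      -(B.halfDeriv γ * v (Fin.last d) * (v ⬝ᵥ δ)) := by
  simp only [bodyForm_wedge_wedge, add_dotProduct, sub_dotProduct, zero_add,
    dotProduct_sub, smul_dotProduct, dotProduct_smul, smul_eq_mul, hv, hδ, hδn,
    halfDeriv, neg_smul, neg_dotProduct]
  ring

/-- This pairs the non-horizontal part of the bracket of two horizontal lifts with a horizontal
vector; it produces the coefficient of the gyroscopic tensor. -/
lemma bodyForm_wedge_tangent (B : RouthSphere) {γ y z δ : Fin (d + 1) → ℝ}
    (hy : γ ⬝ᵥ y = 0) (hz : γ ⬝ᵥ z = 0) :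
    B.bodyForm (wedge y z) 0 (wedge γ δ) (-B.b • δ) =
      -B.halfDeriv γ * ((z (Fin.last d) • y - y (Fin.last d) • z) ⬝ᵥ δ) := by
  simp only [bodyForm_wedge_wedge, sub_dotProduct, zero_add,
    dotProduct_add, dotProduct_sub, smul_dotProduct, dotProduct_smul, smul_eq_mul, hy, hz,
    dotProduct_comm y γ, dotProduct_comm z γ, halfDeriv, neg_smul, dotProduct_neg]
  ring

/-! ### Derivatives along curves -/

lemma hasDerivAt_dotProduct {k : ℕ} {v w : ℝ → Fin k → ℝ} {v' w' : Fin k → ℝ} {t : ℝ}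
    (hv : HasDerivAt v v' t) (hw : HasDerivAt w w' t) :
    HasDerivAt (fun s => v s ⬝ᵥ w s) (v' ⬝ᵥ w t + v t ⬝ᵥ w') t := by
  simp only [dotProduct, ← Finset.sum_add_distrib]
  exact HasDerivAt.fun_sum fun i _ => (hasDerivAt_pi.1 hv i).mul (hasDerivAt_pi.1 hw i)

/-- Written in entries, the form can be differentiated without fixing a norm on matrices. -/
lemma killing_inertia_eq_sum (B : RouthSphere) (Ω Δ : Matrix (Fin (d + 1)) (Fin (d + 1)) ℝ) :
    killing (B.inertia Ω) Δ = ∑ i, ∑ j, -(1 / 2) *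
      ((if i = Fin.last d then B.Jₙ else B.J₁) + (if j = Fin.last d then B.Jₙ else B.J₁)) *
        (Ω i j * Δ j i) := by
  simp only [killing, inertia, massTensor, Matrix.trace, Matrix.diag_apply, Matrix.mul_apply,
    Matrix.add_apply, Finset.mul_sum]
  refine Finset.sum_congr rfl fun i _ => Finset.sum_congr rfl fun j _ => ?_
  rw [← Matrix.mul_apply, ← Matrix.mul_apply, Matrix.diagonal_mul, Matrix.mul_diagonal]
  ring

lemma hasDerivAt_bodyForm (B : RouthSphere) {t : ℝ}
    {Ω Δ : ℝ → Matrix (Fin (d + 1)) (Fin (d + 1)) ℝ} {y η : ℝ → Fin (d + 1) → ℝ}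
    {Ω' Δ' : Matrix (Fin (d + 1)) (Fin (d + 1)) ℝ} {y' η' : Fin (d + 1) → ℝ}
    (hΩ : ∀ i j, HasDerivAt (fun s => Ω s i j) (Ω' i j) t) (hy : HasDerivAt y y' t)
    (hΔ : ∀ i j, HasDerivAt (fun s => Δ s i j) (Δ' i j) t) (hη : HasDerivAt η η' t) :
    HasDerivAt (fun s => B.bodyForm (Ω s) (y s) (Δ s) (η s))
      (B.bodyForm Ω' y' (Δ t) (η t) + B.bodyForm (Ω t) (y t) Δ' η') t := by
  have hcol : ∀ {A : ℝ → Matrix (Fin (d + 1)) (Fin (d + 1)) ℝ}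
      {A' : Matrix (Fin (d + 1)) (Fin (d + 1)) ℝ},
      (∀ i j, HasDerivAt (fun s => A s i j) (A' i j) t) →
        HasDerivAt (fun s => A s *ᵥ en d) (A' *ᵥ en d) t := fun h => by
    refine hasDerivAt_pi.2 fun i => ?_
    simpa [en] using h i (Fin.last d)
  have h1 : HasDerivAt (fun s => killing (B.inertia (Ω s)) (Δ s))
      (killing (B.inertia Ω') (Δ t) + killing (B.inertia (Ω t)) Δ') t := by
    simp only [killing_inertia_eq_sum, ← Finset.sum_add_distrib, ← mul_add]
    exact HasDerivAt.fun_sum fun i _ => HasDerivAt.fun_sum fun j _ =>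
      ((hΩ i j).mul (hΔ j i)).const_mul _
  have h2 := (hasDerivAt_dotProduct (hy.add ((hcol hΩ).const_smul B.ℓ))
    (hη.add ((hcol hΔ).const_smul B.ℓ))).const_mul B.m
  refine (h1.add h2).congr_deriv ?_
  simp only [bodyForm, Pi.add_apply, Pi.smul_apply]
  ring

lemma hasDerivAt_wedge {k : ℕ} {v w : ℝ → Fin k → ℝ} {v' w' : Fin k → ℝ} {t : ℝ}
    (hv : HasDerivAt v v' t) (hw : HasDerivAt w w' t) (i j : Fin k) :
    HasDerivAt (fun s => wedge (v s) (w s) i j) ((wedge v' (w t) + wedge (v t) w') i j) t := by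
  have hv := hasDerivAt_pi.1 hv
  have hw := hasDerivAt_pi.1 hw
  refine (((hv i).mul (hw j)).sub ((hw i).mul (hv j))).congr_deriv ?_
  simp only [wedge, Matrix.add_apply, Matrix.sub_apply, vecMulVec_apply]
  ring

lemma hasDerivAt_conformal (B : RouthSphere) {γ : ℝ → Fin (d + 1) → ℝ} {γ' : Fin (d + 1) → ℝ}
    {t : ℝ} (h : HasDerivAt γ γ' t) :
    HasDerivAt (fun s => B.conformal (γ s)) (2 * B.halfDeriv (γ t) * γ' (Fin.last d)) t := by
  have hn := hasDerivAt_pi.1 h (Fin.last d)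
  refine ((((hn.pow 2).const_mul (B.Jₙ - B.J₁)).const_add (2 * B.J₁)).add
    ((((hn.const_mul B.ℓ).const_add B.b).pow 2).const_mul B.m)).congr_deriv ?_
  simp only [halfDeriv]
  ring

lemma hasDerivAt_of_contDiffOn_two {E : Type*} [NormedAddCommGroup E] [NormedSpace ℝ E] {c : ℝ → E}
    {I : Set ℝ} (hI : IsOpen I) (hc : ContDiffOn ℝ 2 c I) {t : ℝ} (ht : t ∈ I) :
    HasDerivAt c (deriv c t) t ∧ HasDerivAt (deriv c) (deriv (deriv c) t) t := by
  have h2 : ContDiffOn ℝ 1 (deriv c) I :=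
    ((contDiffOn_succ_iff_deriv_of_isOpen (n := 1) hI).1 hc).2.2
  exact ⟨((hc.differentiableOn (by norm_num)).differentiableAt (hI.mem_nhds ht)).hasDerivAt,
    ((h2.differentiableOn (by norm_num)).differentiableAt (hI.mem_nhds ht)).hasDerivAt⟩

/-- A curve in the sphere is orthogonal to its velocity. -/
lemma dotProduct_deriv_eq_zero {k : ℕ} {I : Set ℝ} (hI : IsOpen I) {γ : ℝ → Fin k → ℝ}
    (hs : ∀ t ∈ I, γ t ⬝ᵥ γ t = 1) {t : ℝ} (ht : t ∈ I) {v : Fin k → ℝ} (h : HasDerivAt γ v t) :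
    γ t ⬝ᵥ v = 0 := by
  have h1 := hasDerivAt_dotProduct h h
  have h2 : (fun s => γ s ⬝ᵥ γ s) =ᶠ[nhds t] fun _ => 1 :=
    Filter.eventually_of_mem (hI.mem_nhds ht) hs
  have h3 := h1.unique ((hasDerivAt_const t (1 : ℝ)).congr_of_eventuallyEq h2)
  rw [dotProduct_comm v] at h3
  linarith

/-! ### From the equation in horizontal directions to the conservation laws -/

/-- The horizontal vector `γ_j e_i - γ_i e_j`, the generator of `E_i ∧ E_j`. -/
def rotation (i j : Fin d) (γ : Fin (d + 1) → ℝ) : Fin (d + 1) → ℝ :=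
  γ j.castSucc • Pi.single i.castSucc 1 - γ i.castSucc • Pi.single j.castSucc 1

lemma dotProduct_rotation (i j : Fin d) (γ v : Fin (d + 1) → ℝ) :
    v ⬝ᵥ rotation i j γ = -wedge γ v i.castSucc j.castSucc := by
  simp [rotation, wedge, vecMulVec_apply]
  ring

lemma rotation_last (i j : Fin d) (γ : Fin (d + 1) → ℝ) : rotation i j γ (Fin.last d) = 0 := by
  simp [rotation]

lemma wedge_self {k : ℕ} (y : Fin k → ℝ) : wedge y y = 0 := by simp [wedge]

lemma dotProduct_rotation_self (i j : Fin d) (γ : Fin (d + 1) → ℝ) : γ ⬝ᵥ rotation i j γ = 0 := by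
  simp [dotProduct_rotation, wedge_self]

/-- The equation `f γ̈ · δ + ½ ḟ γ̇ · δ = 0`, `δ` horizontal, implies the conservation laws. -/
lemma firstIntegral_eq_of_equation {B : RouthSphere} (hJ₁ : 0 < B.J₁) (hJₙ : 0 < B.Jₙ)
    (hm : 0 < B.m) {I : Set ℝ} (hI : IsOpen I) (hI' : I.OrdConnected) {γ : ℝ → Fin (d + 1) → ℝ}
    (hγ : ContDiffOn ℝ 2 γ I) (hs : ∀ t ∈ I, γ t ⬝ᵥ γ t = 1)
    (heq : ∀ t ∈ I, ∀ δ, γ t ⬝ᵥ δ = 0 → δ (Fin.last d) = 0 →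
      B.conformal (γ t) * (deriv (deriv γ) t ⬝ᵥ δ) +
        B.halfDeriv (γ t) * deriv γ t (Fin.last d) * (deriv γ t ⬝ᵥ δ) = 0)
    (i j : Fin d) {t₁ t₂ : ℝ} (h₁ : t₁ ∈ I) (h₂ : t₂ ∈ I) :
    B.firstIntegral i j (γ t₁) (wedge (γ t₁) (deriv γ t₁)) =
      B.firstIntegral i j (γ t₂) (wedge (γ t₂) (deriv γ t₂)) := by
  have key : ∀ t ∈ I, HasDerivAt
      (fun s => B.firstIntegral i j (γ s) (wedge (γ s) (deriv γ s))) 0 t := fun t ht => by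
    obtain ⟨hv, ha⟩ := hasDerivAt_of_contDiffOn_two hI hγ ht
    have hpos := conformal_pos hJ₁ hJₙ hm (hs t ht)
    have hsqrt := Real.sqrt_pos.2 hpos
    refine (((hasDerivAt_conformal B hv).sqrt hpos.ne').mul
      (hasDerivAt_wedge hv ha i.castSucc j.castSucc)).congr_deriv ?_
    -- In this direction `γ̇ · δ = -Ω_ij` and `γ̈ · δ = -Ω̇_ij`, because `γ̇ ∧ γ̇ = 0`. Up to sign,
    -- the equation is `√f` times the derivative that has to vanish.
    have h := heq t ht _ (dotProduct_rotation_self i j _) (rotation_last i j _)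
    simp only [dotProduct_rotation] at h
    rw [wedge_self, zero_add]
    have hsq := Real.mul_self_sqrt hpos.le
    field_simp
    rw [sq, hsq]
    linarith
  exact hI.is_const_of_deriv_eq_zero hI'.isPreconnected
    (fun t ht => (key t ht).differentiableAt.differentiableWithinAt)
    (fun t ht => (key t ht).deriv) h₁ h₂

/-! ### The Euler–Lagrange expressions -/

lemma deriv_reducedLagrangian_velocity (B : RouthSphere) (γ v δ : Fin (d + 1) → ℝ) :
    deriv (fun ε : ℝ => B.reducedLagrangian γ (v + ε • δ)) 0 = B.metricS γ v δ := by
  have h1 : HasDerivAt (fun ε : ℝ => v + ε • δ) δ 0 := by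
    simpa using ((hasDerivAt_id (0 : ℝ)).smul_const δ).const_add v
  have h2 := hasDerivAt_wedge (hasDerivAt_const (0 : ℝ) γ) h1
  have h3 := h1.const_smul (-B.b)
  have h4 := ((hasDerivAt_bodyForm B h2 h3 h2 h3).const_mul (1 / 2)).sub_const
    (B.m * B.𝒢 * B.ℓ * γ (Fin.last d))
  refine (h4.congr_deriv ?_).deriv
  have h0 : wedge (0 : Fin (d + 1) → ℝ) v = 0 := by simp [wedge]
  simp only [zero_smul, add_zero, h0, zero_add, Pi.smul_apply]
  rw [metricS_eq_bodyForm, bodyForm_comm B (wedge γ δ)]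
  ring

/-- The last slot of the form is `0` because the translational velocity `-b v` does not involve `γ`.
-/
lemma deriv_reducedLagrangian_position (B : RouthSphere) (γ v δ : Fin (d + 1) → ℝ) :
    deriv (fun ε : ℝ => B.reducedLagrangian (γ + ε • δ) v) 0 =
      B.bodyForm (wedge γ v) (-B.b • v) (wedge δ v) 0 -
        B.m * B.𝒢 * B.ℓ * δ (Fin.last d) := by
  have h1 : HasDerivAt (fun ε : ℝ => γ + ε • δ) δ 0 := by
    simpa using ((hasDerivAt_id (0 : ℝ)).smul_const δ).const_add γ
  have h2 := hasDerivAt_wedge h1 (hasDerivAt_const (0 : ℝ) v)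
  have h3 := hasDerivAt_const (0 : ℝ) (-B.b • v)
  have h4 := ((hasDerivAt_bodyForm B h2 h3 h2 h3).const_mul (1 / 2)).sub
    ((hasDerivAt_pi.1 h1 (Fin.last d)).const_mul (B.m * B.𝒢 * B.ℓ))
  refine (h4.congr_deriv ?_).deriv
  have h0 : wedge γ (0 : Fin (d + 1) → ℝ) = 0 := by simp [wedge]
  simp only [zero_smul, add_zero, h0]
  rw [bodyForm_comm B (wedge δ v)]
  ring

/-- The momentum term and the position term each contribute `h γ̇_n γ̇ · δ`. The fixed `δ` need not
stay tangent along the curve, so the momentum is differentiated with the ambient formula of the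
metric and not with its tangential form. -/
lemma eulerLagrange_reducedLagrangian (B : RouthSphere) {I : Set ℝ} (hI : IsOpen I)
    {γ : ℝ → Fin (d + 1) → ℝ} (hγ : ContDiffOn ℝ 2 γ I) (hs : ∀ t ∈ I, γ t ⬝ᵥ γ t = 1)
    {t : ℝ} (ht : t ∈ I) {δ : Fin (d + 1) → ℝ} (hδ : γ t ⬝ᵥ δ = 0) (hδn : δ (Fin.last d) = 0) :
    eulerLagrange B.reducedLagrangian γ t δ =
      B.conformal (γ t) * (deriv (deriv γ) t ⬝ᵥ δ) +
        2 * B.halfDeriv (γ t) * deriv γ t (Fin.last d) * (deriv γ t ⬝ᵥ δ) := by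
  obtain ⟨hv, ha⟩ := hasDerivAt_of_contDiffOn_two hI hγ ht
  have hγv := dotProduct_deriv_eq_zero hI hs ht hv
  have h1 := hasDerivAt_bodyForm B (hasDerivAt_wedge hv ha) (ha.const_smul (-B.b))
    (hasDerivAt_wedge hv (hasDerivAt_const t δ)) (hasDerivAt_const t (-B.b • δ))
  have h0 : wedge (γ t) (0 : Fin (d + 1) → ℝ) = 0 := by simp [wedge]
  have h2 := bodyForm_add_bodyForm_horizontal B (a := deriv (deriv γ) t) (hs t ht) hγv hδ hδn
  simp only [eulerLagrange, deriv_reducedLagrangian_velocity, deriv_reducedLagrangian_position,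
    bodyForm_wedge_horizontal B hγv hδ hδn, hδn]
  have h3 : deriv (fun s => B.metricS (γ s) (deriv γ s) δ) t = _ := h1.deriv
  rw [h3, h0, add_zero]
  simp only [Pi.smul_apply]
  rw [h2]
  ring

/-! ### Motions of the sphere -/

section

attribute [local instance] Matrix.normedAddCommGroup Matrix.normedSpace

lemma hasDerivAt_fst_apply {c : ℝ → Ambient d} {V : Ambient d} {t : ℝ} (h : HasDerivAt c V t)
    (i j : Fin (d + 1)) : HasDerivAt (fun s => (c s).1 i j) (V.1 i j) t :=
  hasDerivAt_pi.1 (hasDerivAt_pi.1 h.fst i) j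

lemma hasDerivAt_snd {c : ℝ → Ambient d} {V : Ambient d} {t : ℝ} (h : HasDerivAt c V t) :
    HasDerivAt (fun s => (c s).2) V.2 t := h.snd

lemma poisson_apply (q : Ambient d) (i : Fin (d + 1)) : poisson q i = q.1 (Fin.last d) i := by
  simp [poisson, en]

lemma contDiff_fst_apply {n : ℕ∞} (i j : Fin (d + 1)) :
    ContDiff ℝ n (fun q : Ambient d => q.1 i j) :=
  (contDiff_apply_apply ℝ ℝ i j).comp contDiff_fst

lemma contDiff_poisson {n : ℕ∞} : ContDiff ℝ n (poisson (d := d)) :=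
  contDiff_pi.2 fun i => by
    simp only [poisson_apply]
    exact contDiff_fst_apply _ _

lemma IsMotion.contDiffOn_poisson {B : RouthSphere} {I : Set ℝ} {c : ℝ → Ambient d}
    (hc : B.IsMotion I c) : ContDiffOn ℝ 2 (fun s => poisson (c s)) I :=
  contDiff_poisson.comp_contDiffOn hc.contDiffOn

lemma IsMotion.hasDerivAt {B : RouthSphere} {I : Set ℝ} (hI : IsOpen I) {c : ℝ → Ambient d}
    (hc : B.IsMotion I c) {t : ℝ} (ht : t ∈ I) : HasDerivAt c (deriv c t) t :=
  (hasDerivAt_of_contDiffOn_two hI hc.contDiffOn ht).1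

end

lemma hasDerivAt_const_apply {k : ℕ} (t : ℝ) (M : Matrix (Fin k) (Fin k) ℝ) (i j : Fin k) :
    HasDerivAt (fun _ : ℝ => M i j) ((0 : Matrix (Fin k) (Fin k) ℝ) i j) t :=
  hasDerivAt_const t (M i j)

lemma hasDerivAt_poisson {c : ℝ → Ambient d} {V : Ambient d} {t : ℝ}
    (h : ∀ i j, HasDerivAt (fun s => (c s).1 i j) (V.1 i j) t) :
    HasDerivAt (fun s => poisson (c s)) (tangentPoisson V) t := by
  refine hasDerivAt_pi.2 fun i => ?_
  simpa [tangentPoisson, en, poisson_apply] using h (Fin.last d) i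

lemma poisson_dotProduct_self {B : RouthSphere} {q : Ambient d} (hq : q ∈ configSpace d B) :
    poisson q ⬝ᵥ poisson q = 1 := by
  have hγ : q.1 *ᵥ poisson q = en d := by simp [poisson, mul_transpose_self_of_mem hq]
  nth_rw 1 [poisson]
  rw [Matrix.mulVec_transpose, ← Matrix.dotProduct_mulVec, hγ]
  simp [en]

lemma hasDerivAt_mul_apply {k : ℕ} {M N : ℝ → Matrix (Fin k) (Fin k) ℝ}
    {M' N' : Matrix (Fin k) (Fin k) ℝ} {t : ℝ}
    (hM : ∀ i j, HasDerivAt (fun s => M s i j) (M' i j) t)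
    (hN : ∀ i j, HasDerivAt (fun s => N s i j) (N' i j) t) (i j : Fin k) :
    HasDerivAt (fun s => (M s * N s) i j) ((M' * N t + M t * N') i j) t := by
  simp only [Matrix.mul_apply, Matrix.add_apply, ← Finset.sum_add_distrib]
  exact HasDerivAt.fun_sum fun k _ => (hM i k).mul (hN k j)

lemma hasDerivAt_mulVec {k : ℕ} {M : ℝ → Matrix (Fin k) (Fin k) ℝ} {y : ℝ → Fin k → ℝ}
    {M' : Matrix (Fin k) (Fin k) ℝ} {y' : Fin k → ℝ} {t : ℝ}
    (hM : ∀ i j, HasDerivAt (fun s => M s i j) (M' i j) t) (hy : HasDerivAt y y' t) :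
    HasDerivAt (fun s => M s *ᵥ y s) (M' *ᵥ y t + M t *ᵥ y') t :=
  hasDerivAt_pi.2 fun i => hasDerivAt_dotProduct (hasDerivAt_pi.2 fun j => hM i j) hy

lemma deriv_lagrangian_velocity (B : RouthSphere) (q V δ : Ambient d) :
    deriv (fun ε : ℝ => B.lagrangian q (V + ε • δ)) 0 = B.metric q V δ := by
  have h1 : ∀ i j, HasDerivAt (fun ε : ℝ => (V + ε • δ).1 i j) (δ.1 i j) 0 := fun i j => by
    simpa using ((hasDerivAt_id (0 : ℝ)).mul_const (δ.1 i j)).const_add (V.1 i j)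
  have h2 : HasDerivAt (fun ε : ℝ => (V + ε • δ).2) δ.2 0 := by
    simpa using ((hasDerivAt_id (0 : ℝ)).smul_const δ.2).const_add V.2
  have hq := hasDerivAt_const_apply 0 q.1ᵀ
  have h3 := hasDerivAt_mul_apply hq h1
  have h4 := hasDerivAt_mulVec hq h2
  have h5 := ((hasDerivAt_bodyForm B h3 h4 h3 h4).const_mul (1 / 2)).sub_const
    (B.m * B.𝒢 * B.ℓ * poisson q (Fin.last d))
  refine (h5.congr_deriv ?_).deriv
  simp only [zero_smul, add_zero, Matrix.zero_mul, Matrix.zero_mulVec, zero_add]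
  rw [metric_eq_bodyForm, bodyForm_comm B (q.1ᵀ * δ.1)]
  ring

lemma deriv_lagrangian_position (B : RouthSphere) (q V δ : Ambient d) :
    deriv (fun ε : ℝ => B.lagrangian (q + ε • δ) V) 0 =
      B.bodyForm (q.1ᵀ * V.1) (q.1ᵀ *ᵥ V.2) (δ.1ᵀ * V.1) (δ.1ᵀ *ᵥ V.2) -
        B.m * B.𝒢 * B.ℓ * tangentPoisson δ (Fin.last d) := by
  have h1 : ∀ i j, HasDerivAt (fun ε : ℝ => (q + ε • δ).1 i j) (δ.1 i j) 0 := fun i j => by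
    simpa using ((hasDerivAt_id (0 : ℝ)).mul_const (δ.1 i j)).const_add (q.1 i j)
  have hq : ∀ i j, HasDerivAt (fun ε : ℝ => (q + ε • δ).1ᵀ i j) (δ.1ᵀ i j) 0 := fun i j => h1 j i
  have h3 := hasDerivAt_mul_apply hq (hasDerivAt_const_apply 0 V.1)
  have h4 := hasDerivAt_mulVec hq (hasDerivAt_const (0 : ℝ) V.2)
  have h5 := ((hasDerivAt_bodyForm B h3 h4 h3 h4).const_mul (1 / 2)).sub
    ((hasDerivAt_pi.1 (hasDerivAt_poisson h1) (Fin.last d)).const_mul (B.m * B.𝒢 * B.ℓ))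
  refine (h5.congr_deriv ?_).deriv
  simp only [zero_smul, add_zero, Matrix.mul_zero, Matrix.mulVec_zero]
  rw [bodyForm_comm B (δ.1ᵀ * V.1)]
  ring

lemma hor_fst_transpose (B : RouthSphere) (q : Ambient d) (v : Fin (d + 1) → ℝ) :
    (B.hor q v).1ᵀ = -(wedge (poisson q) v * q.1ᵀ) := by
  simp [hor, wedge_transpose]

lemma transpose_mulVec_hor_snd {B : RouthSphere} {q : Ambient d} (hq : q ∈ configSpace d B)
    (v : Fin (d + 1) → ℝ) : q.1ᵀ *ᵥ (B.hor q v).2 = -B.b • v := by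
  simp [hor, Matrix.mulVec_smul, Matrix.mulVec_neg, transpose_mul_self_of_mem hq]

/-- Each product is `-(v · w) γ γᵗ` minus a rank-one matrix, and the first term is symmetric in `v,
w`. The commutator `v ∧ w` annihilates `γ`: the bracket of two horizontal rotations is a rotation
about `γ`. -/
lemma wedge_mul_wedge_comm {k : ℕ} {γ v w : Fin k → ℝ} (h : γ ⬝ᵥ γ = 1) (hv : γ ⬝ᵥ v = 0)
    (hw : γ ⬝ᵥ w = 0) :
    wedge γ w * wedge γ v - wedge γ v * wedge γ w = wedge v w := by
  have h1 : ∀ {v w : Fin k → ℝ}, γ ⬝ᵥ v = 0 → γ ⬝ᵥ w = 0 →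
      wedge γ w * wedge γ v = -(v ⬝ᵥ w) • vecMulVec γ γ - vecMulVec w v := fun {v w} hv hw => by
    simp only [wedge, Matrix.mul_sub, Matrix.sub_mul, Matrix.vecMulVec_mul_vecMulVec,
      dotProduct_comm w, h, hv, hw]
    ext i j
    simp [vecMulVec_apply]
    ring
  rw [h1 hv hw, h1 hw hv, wedge, dotProduct_comm w v]
  abel

lemma IsMotion.deriv_eq_hor {B : RouthSphere} {I : Set ℝ} (hI : IsOpen I) {c : ℝ → Ambient d}
    (hc : B.IsMotion I c) {t : ℝ} (ht : t ∈ I) :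
    deriv c t = B.hor (c t) (deriv (fun s => poisson (c s)) t) := by
  have h1 := hasDerivAt_poisson
    (hasDerivAt_fst_apply (hc.hasDerivAt hI ht))
  have h2 := dotProduct_deriv_eq_zero hI
    (fun s hs => poisson_dotProduct_self (hc.mem_configSpace s hs)) ht h1
  rw [h1.deriv]
  exact (mem_distribution_iff_eq_hor (hc.mem_configSpace t ht) h2 _).1 ⟨hc.constraint t ht, rfl⟩

/-- In the body frame, the variation of `R` in the momentum term and in the position term combine to
a commutator of horizontal rotations, which is `γ̇ ∧ δ`. Hence only one copy of `h γ̇_n γ̇ · δ`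
appears, without any gyroscopic correction. -/
lemma IsMotion.eulerLagrange_lagrangian {B : RouthSphere} {I : Set ℝ} (hI : IsOpen I)
    {c : ℝ → Ambient d} (hc : B.IsMotion I c) {t : ℝ} (ht : t ∈ I) {δ : Fin (d + 1) → ℝ}
    (hδ : poisson (c t) ⬝ᵥ δ = 0) (hδn : δ (Fin.last d) = 0) :
    eulerLagrange B.lagrangian c t (B.hor (c t) δ) =
      B.conformal (poisson (c t)) * (deriv (deriv fun s => poisson (c s)) t ⬝ᵥ δ) +
        B.halfDeriv (poisson (c t)) * deriv (fun s => poisson (c s)) t (Fin.last d) *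
          (deriv (fun s => poisson (c s)) t ⬝ᵥ δ) := by
  set γ : ℝ → Fin (d + 1) → ℝ := fun s => poisson (c s)
  have hs : ∀ s ∈ I, γ s ⬝ᵥ γ s = 1 := fun s hs => poisson_dotProduct_self (hc.mem_configSpace s hs)
  obtain ⟨hv, ha⟩ := hasDerivAt_of_contDiffOn_two hI hc.contDiffOn_poisson ht
  have hγv := dotProduct_deriv_eq_zero hI hs ht hv
  have hq := hc.mem_configSpace t ht
  have hcd := hc.hasDerivAt hI ht
  set X := B.hor (c t) δ with hX
  have hR : ∀ i j, HasDerivAt (fun s => (c s).1ᵀ i j) ((deriv c t).1ᵀ i j) t :=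
    fun i j => hasDerivAt_fst_apply hcd j i
  have h1 : HasDerivAt (fun s => B.bodyForm (wedge (γ s) (deriv γ s)) (-B.b • deriv γ s)
      ((c s).1ᵀ * X.1) ((c s).1ᵀ *ᵥ X.2)) _ t :=
    hasDerivAt_bodyForm B (hasDerivAt_wedge hv ha) (ha.const_smul (-B.b))
    (hasDerivAt_mul_apply hR (hasDerivAt_const_apply t X.1))
    (hasDerivAt_mulVec hR (hasDerivAt_const t X.2))
  -- The velocity may be replaced by a horizontal lift before differentiating, since the constraints
  -- hold on a neighbourhood of `t`. The test vector `X` is constant and is horizontal only at `t`.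
  have h2 : (fun s => B.metric (c s) (deriv c s) X) =ᶠ[nhds t]
      (fun s => B.bodyForm (wedge (γ s) (deriv γ s)) (-B.b • deriv γ s)
        ((c s).1ᵀ * X.1) ((c s).1ᵀ *ᵥ X.2)) := by
    filter_upwards [hI.mem_nhds ht] with s hs
    have hqs := hc.mem_configSpace s hs
    rw [metric_eq_bodyForm, hc.deriv_eq_hor hI hs, transpose_mulVec_hor_snd hqs]
    congr 1
    exact bodyVelocity_hor hqs _
  have e1 : (c t).1ᵀ * X.1 = wedge (γ t) δ := bodyVelocity_hor hq _
  have e2 : (c t).1ᵀ *ᵥ X.2 = -B.b • δ := transpose_mulVec_hor_snd hq _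
  have e3 : (c t).1ᵀ * (deriv c t).1 = wedge (γ t) (deriv γ t) := by
    rw [hc.deriv_eq_hor hI ht]; exact bodyVelocity_hor hq _
  have e4 : (c t).1ᵀ *ᵥ (deriv c t).2 = -B.b • deriv γ t := by
    rw [hc.deriv_eq_hor hI ht]; exact transpose_mulVec_hor_snd hq _
  have e5 : (deriv c t).1ᵀ = -(wedge (γ t) (deriv γ t) * (c t).1ᵀ) := by
    rw [hc.deriv_eq_hor hI ht, hor_fst_transpose]
  have e6 : X.1ᵀ = -(wedge (γ t) δ * (c t).1ᵀ) := hor_fst_transpose _ _ _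
  have e7 : tangentPoisson X (Fin.last d) = 0 := by
    rw [((mem_distribution_iff_eq_hor hq hδ _).2 hX).2, hδn]
  simp only [eulerLagrange, deriv_lagrangian_velocity, deriv_lagrangian_position]
  rw [h2.deriv_eq, h1.deriv, e5, e6, e7]
  simp only [Matrix.neg_mul, Matrix.neg_mulVec, Matrix.mul_assoc, ← Matrix.mulVec_mulVec, e1, e2,
    e3, e4, Matrix.mulVec_zero, add_zero, mul_zero, sub_zero]
  rw [add_sub_assoc, ← bodyForm_sub_right]
  have e8 : -(wedge (γ t) (deriv γ t) * wedge (γ t) δ) -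
      -(wedge (γ t) δ * wedge (γ t) (deriv γ t)) = wedge (deriv γ t) δ := by
    rw [← wedge_mul_wedge_comm (hs t ht) hγv hδ]
    abel
  -- Both translational terms equal `b (γ̇ · δ) γ`, so they cancel.
  have e9 : -(wedge (γ t) (deriv γ t) *ᵥ (-B.b • δ)) -
      -(wedge (γ t) δ *ᵥ (-B.b • deriv γ t)) = 0 := by
    have h3 : γ t ⬝ᵥ δ = 0 := hδ
    have h4 : γ t ⬝ᵥ deriv γ t = 0 := hγv
    simp [wedge_mulVec, dotProduct_comm δ, h3, h4]
  rw [e8, e9, bodyForm_add_bodyForm_horizontal B (hs t ht) hγv hδ hδn]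

lemma IsMotion.equation {B : RouthSphere} {I : Set ℝ} (hI : IsOpen I)
    {c : ℝ → Ambient d} (hc : B.IsMotion I c) {t : ℝ} (ht : t ∈ I) {δ : Fin (d + 1) → ℝ}
    (hδ : poisson (c t) ⬝ᵥ δ = 0) (hδn : δ (Fin.last d) = 0) :
      B.conformal (poisson (c t)) * (deriv (deriv fun s => poisson (c s)) t ⬝ᵥ δ) +
        B.halfDeriv (poisson (c t)) * deriv (fun s => poisson (c s)) t (Fin.last d) *
          (deriv (fun s => poisson (c s)) t ⬝ᵥ δ) = 0 := by
  rw [← hc.eulerLagrange_lagrangian hI ht hδ hδn]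
  exact hc.lagrange_dAlembert t ht _
    ((mem_distribution_iff_eq_hor (hc.mem_configSpace t ht) hδ _).2 rfl).1

lemma IsMotion.firstIntegral_eq {B : RouthSphere} (hJ₁ : 0 < B.J₁) (hJₙ : 0 < B.Jₙ) (hm : 0 < B.m)
    {I : Set ℝ} (hI : IsOpen I) (hI' : I.OrdConnected) {c : ℝ → Ambient d} (hc : B.IsMotion I c)
    (i j : Fin d) {t₁ t₂ : ℝ} (h₁ : t₁ ∈ I) (h₂ : t₂ ∈ I) :
    B.firstIntegral i j (poisson (c t₁)) (bodyVelocity (c t₁) (deriv c t₁)) =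
      B.firstIntegral i j (poisson (c t₂)) (bodyVelocity (c t₂) (deriv c t₂)) := by
  rw [hc.deriv_eq_hor hI h₁, hc.deriv_eq_hor hI h₂, bodyVelocity_hor (hc.mem_configSpace _ h₁),
    bodyVelocity_hor (hc.mem_configSpace _ h₂)]
  exact firstIntegral_eq_of_equation hJ₁ hJₙ hm hI hI' hc.contDiffOn_poisson
    (fun t ht => poisson_dotProduct_self (hc.mem_configSpace t ht))
    (fun t ht δ hδ hδn => hc.equation hI ht hδ hδn) i j h₁ h₂

lemma IsReducedMotion.firstIntegral_eq {B : RouthSphere} (hJ₁ : 0 < B.J₁) (hJₙ : 0 < B.Jₙ)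
    (hm : 0 < B.m) {I : Set ℝ} (hI : IsOpen I) (hI' : I.OrdConnected) {γ : ℝ → Fin (d + 1) → ℝ}
    (hγ : B.IsReducedMotion I γ) (i j : Fin d) {t₁ t₂ : ℝ} (h₁ : t₁ ∈ I) (h₂ : t₂ ∈ I) :
    B.firstIntegral i j (γ t₁) (wedge (γ t₁) (deriv γ t₁)) =
      B.firstIntegral i j (γ t₂) (wedge (γ t₂) (deriv γ t₂)) := by
  obtain ⟨c, hc, hγc⟩ := hγ
  -- The two curves agree only on `I`; openness of `I` makes their derivatives agree there.
  have hd : ∀ t ∈ I, deriv γ t = deriv (fun s => poisson (c s)) t := fun t ht =>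
    Filter.EventuallyEq.deriv_eq (Filter.eventually_of_mem (hI.mem_nhds ht) hγc)
  rw [hd _ h₁, hd _ h₂, hγc _ h₁, hγc _ h₂]
  exact firstIntegral_eq_of_equation hJ₁ hJₙ hm hI hI' hc.contDiffOn_poisson
    (fun t ht => poisson_dotProduct_self (hc.mem_configSpace t ht))
    (fun t ht δ hδ hδn => hc.equation hI ht hδ hδn) i j h₁ h₂

/-! ### The gyroscopic tensor -/

/-- Differentiation of the tangency condition of a field on the sphere. -/
lemma IsSphereField.dotProduct_fderiv {Y : (Fin (d + 1) → ℝ) → (Fin (d + 1) → ℝ)}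
    (hY : IsSphereField Y) {s w : Fin (d + 1) → ℝ} (hs : s ⬝ᵥ s = 1) (hw : s ⬝ᵥ w = 0) :
    s ⬝ᵥ fderiv ℝ Y s w = -(w ⬝ᵥ Y s) := by
  -- The normalised line through `s` is a curve on the sphere with velocity `w` at `0`; tangency of
  -- `Y` is available only on the sphere.
  set x : ℝ → Fin (d + 1) → ℝ := fun τ => (√(1 + τ ^ 2 * (w ⬝ᵥ w)))⁻¹ • (s + τ • w)
  have hpos : ∀ τ : ℝ, 0 < 1 + τ ^ 2 * (w ⬝ᵥ w) := fun τ => by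
    have : 0 ≤ w ⬝ᵥ w := Finset.sum_nonneg fun i _ => mul_self_nonneg (w i)
    positivity
  have hx0 : x 0 = s := by simp [x]
  have hx : HasDerivAt x w 0 := by
    have h1 : HasDerivAt (fun τ : ℝ => 1 + τ ^ 2 * (w ⬝ᵥ w)) 0 0 := by
      simpa using (((hasDerivAt_id (0 : ℝ)).pow 2).mul_const (w ⬝ᵥ w)).const_add 1
    have h2 : HasDerivAt (fun τ : ℝ => s + τ • w) w 0 := by
      simpa using ((hasDerivAt_id (0 : ℝ)).smul_const w).const_add s
    refine (((h1.sqrt (hpos 0).ne').inv (Real.sqrt_pos.2 (hpos 0)).ne').smul h2).congr_deriv ?_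
    simp
  have hxx : ∀ τ, x τ ⬝ᵥ x τ = 1 := fun τ => by
    have hsq := Real.mul_self_sqrt (hpos τ).le
    have hne := (Real.sqrt_pos.2 (hpos τ)).ne'
    simp only [x, smul_dotProduct, dotProduct_smul, add_dotProduct, dotProduct_add, smul_eq_mul,
      hs, hw, dotProduct_comm w s]
    field_simp
    rw [sq √_, hsq]
    ring
  have hYx : HasDerivAt (fun τ => Y (x τ)) (fderiv ℝ Y s w) 0 := by
    have h := (hY.contDiff.differentiable (by simp) (x 0)).hasFDerivAt.comp_hasDerivAt 0 hx
    rwa [hx0] at h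
  have h1 := hasDerivAt_dotProduct hx hYx
  have h2 : (fun τ => x τ ⬝ᵥ Y (x τ)) = fun _ => 0 := funext fun τ => hY.tangent _ (hxx τ)
  rw [h2] at h1
  have h3 := h1.unique (hasDerivAt_const (0 : ℝ) (0 : ℝ))
  rw [hx0] at h3
  linarith

lemma IsSphereField.lieBracket_tangent {Y Z : (Fin (d + 1) → ℝ) → (Fin (d + 1) → ℝ)}
    (hY : IsSphereField Y) (hZ : IsSphereField Z) {s : Fin (d + 1) → ℝ} (hs : s ⬝ᵥ s = 1) :
    s ⬝ᵥ VectorField.lieBracket ℝ Y Z s = 0 := by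
  rw [VectorField.lieBracket, dotProduct_sub, hZ.dotProduct_fderiv hs (hY.tangent s hs),
    hY.dotProduct_fderiv hs (hZ.tangent s hs), dotProduct_comm]
  simp

lemma wedge_add_right {k : ℕ} (y z w : Fin k → ℝ) :
    wedge y (z + w) = wedge y z + wedge y w := by
  simp only [wedge, Matrix.vecMulVec_add, Matrix.add_vecMulVec]
  abel

lemma wedge_sub_right {k : ℕ} (y z w : Fin k → ℝ) :
    wedge y (z - w) = wedge y z - wedge y w := by
  rw [eq_sub_iff_add_eq, ← wedge_add_right, sub_add_cancel]

lemma wedge_comm {k : ℕ} (y z : Fin k → ℝ) : wedge y z = -wedge z y := by simp [wedge]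

lemma tangentPoisson_hor {B : RouthSphere} {q : Ambient d} (hq : q ∈ configSpace d B)
    {v : Fin (d + 1) → ℝ} (hv : poisson q ⬝ᵥ v = 0) : tangentPoisson (B.hor q v) = v :=
  ((mem_distribution_iff_eq_hor hq hv _).2 rfl).2

lemma poisson_dotProduct_tangentPoisson {B : RouthSphere} {q V : Ambient d}
    (hq : q ∈ configSpace d B) (hV : V ∈ B.distribution q) :
    poisson q ⬝ᵥ tangentPoisson V = 0 := by
  have h1 : tangentPoisson V = (bodyVelocity q V)ᵀ *ᵥ poisson q := by
    simp [tangentPoisson, poisson, bodyVelocity, Matrix.mul_assoc, mul_transpose_self_of_mem hq]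
  have h2 : poisson q ⬝ᵥ ((bodyVelocity q V)ᵀ *ᵥ poisson q) =
      poisson q ⬝ᵥ (bodyVelocity q V *ᵥ poisson q) := by
    rw [Matrix.mulVec_transpose, Matrix.dotProduct_mulVec, dotProduct_comm]
  rw [hV.1.1, Matrix.neg_mulVec, dotProduct_neg] at h2
  rw [h1, hV.1.1, Matrix.neg_mulVec, dotProduct_neg]
  linarith

section

attribute [local instance] Matrix.normedAddCommGroup Matrix.normedSpace

lemma contDiff_horField (B : RouthSphere) {Y : (Fin (d + 1) → ℝ) → (Fin (d + 1) → ℝ)}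
    (hY : ContDiff ℝ (⊤ : ℕ∞) Y) : ContDiff ℝ (⊤ : ℕ∞) (B.horField Y) := by
  have h1 : ContDiff ℝ (⊤ : ℕ∞) fun q : Ambient d => Y (poisson q) := hY.comp contDiff_poisson
  have h2 := contDiff_pi.1 h1
  have h3 := contDiff_pi.1 (contDiff_poisson (d := d) (n := ⊤))
  have h4 : ∀ i j, ContDiff ℝ (⊤ : ℕ∞) fun q : Ambient d => (B.horField Y q).1 i j := fun i j => by
    simp only [horField, hor, Matrix.mul_apply, wedge, Matrix.sub_apply, vecMulVec_apply]
    exact ContDiff.sum fun k _ => (contDiff_fst_apply i k).mul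
      (((h3 k).mul (h2 j)).sub ((h2 k).mul (h3 j)))
  have h5 : ∀ i, ContDiff ℝ (⊤ : ℕ∞) fun q : Ambient d => (B.horField Y q).2 i := fun i => by
    simp only [horField, hor, Pi.smul_apply, Matrix.mulVec, dotProduct]
    exact (ContDiff.sum fun k _ => (contDiff_fst_apply i k).mul (h2 k)).const_smul _
  exact ContDiff.prodMk (contDiff_pi.2 fun i => contDiff_pi.2 fun j => h4 i j) (contDiff_pi.2 h5)

lemma fderiv_horField (B : RouthSphere) {Y : (Fin (d + 1) → ℝ) → (Fin (d + 1) → ℝ)}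
    (hY : ContDiff ℝ (⊤ : ℕ∞) Y) (q W : Ambient d) :
    fderiv ℝ (B.horField Y) q W =
      (W.1 * wedge (poisson q) (Y (poisson q)) + q.1 * (wedge (tangentPoisson W) (Y (poisson q)) +
          wedge (poisson q) (fderiv ℝ Y (poisson q) (tangentPoisson W))),
        -B.b • (W.1 *ᵥ Y (poisson q) + q.1 *ᵥ fderiv ℝ Y (poisson q) (tangentPoisson W))) := by
  have hc : HasDerivAt (fun ε : ℝ => q + ε • W) W 0 :=
    (((hasDerivAt_id (0 : ℝ)).smul_const W).const_add q).congr_deriv (one_smul ℝ W)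
  have h0 : q + (0 : ℝ) • W = q := by simp
  have h1 : HasDerivAt (fun ε : ℝ => B.horField Y (q + ε • W)) (fderiv ℝ (B.horField Y) q W) 0 := by
    have h := ((contDiff_horField B hY).differentiable (by simp)
      (q + (0 : ℝ) • W)).hasFDerivAt.comp_hasDerivAt (0 : ℝ) hc
    rwa [h0] at h
  have hR := hasDerivAt_fst_apply hc
  have h2 := hasDerivAt_poisson hR
  have h3 : HasDerivAt (fun ε : ℝ => Y (poisson (q + ε • W)))
      (fderiv ℝ Y (poisson q) (tangentPoisson W)) 0 := by
    have h := (hY.differentiable (by simp)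
      (poisson (q + (0 : ℝ) • W))).hasFDerivAt.comp_hasDerivAt (0 : ℝ) h2
    rwa [h0] at h
  have h4 := hasDerivAt_mul_apply hR (hasDerivAt_wedge h2 h3)
  have h5 := (hasDerivAt_mulVec hR h3).const_smul (-B.b)
  rw [h0] at h4 h5
  refine Prod.ext ?_ ((hasDerivAt_snd h1).unique h5)
  ext i j
  exact (hasDerivAt_fst_apply h1 i j).unique (h4 i j)

/-- The extra term is the curvature of the lift. The commutator of `γ ∧ Y` and `γ ∧ Z` contributes
`-Y ∧ Z`, and the variation of `γ` inside the two lifts contributes `2 Y ∧ Z`. -/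
lemma lieBracket_horField {B : RouthSphere} {Y Z : (Fin (d + 1) → ℝ) → (Fin (d + 1) → ℝ)}
    (hY : IsSphereField Y) (hZ : IsSphereField Z) {q : Ambient d} (hq : q ∈ configSpace d B) :
    VectorField.lieBracket ℝ (B.horField Y) (B.horField Z) q =
      B.hor q (VectorField.lieBracket ℝ Y Z (poisson q)) +
        (q.1 * wedge (Y (poisson q)) (Z (poisson q)), 0) := by
  have hγ := poisson_dotProduct_self hq
  have hYγ := hY.tangent _ hγ
  have hZγ := hZ.tangent _ hγ
  refine (congrArg₂ (· - ·) (fderiv_horField B hZ.contDiff q _)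
    (fderiv_horField B hY.contDiff q _)).trans ?_
  simp only [VectorField.lieBracket, horField, tangentPoisson_hor hq hYγ, tangentPoisson_hor hq hZγ]
  ext1
  · have h := wedge_mul_wedge_comm hγ hZγ hYγ
    simp only [hor, Prod.fst_sub, Prod.fst_add, wedge_sub_right, Matrix.mul_assoc,
      ← Matrix.mul_add, ← Matrix.mul_sub]
    congr 1
    rw [wedge_comm (Z (poisson q)) (Y (poisson q))] at h ⊢
    rw [sub_eq_iff_eq_add] at h
    rw [h]
    abel
  -- There is no extra translation: `(γ ∧ Y) Z = (Y · Z) γ` is symmetric in `Y, Z`.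
  · simp only [hor, Prod.snd_sub, Prod.snd_add, ← Matrix.mulVec_mulVec, wedge_mulVec, hYγ, hZγ,
      dotProduct_comm (Z (poisson q)) (Y (poisson q)), Matrix.mulVec_sub, smul_sub, smul_add, zero_smul,
      Matrix.mulVec_zero, smul_zero]
    abel

lemma differentiableAt_phi {B : RouthSphere} {s : Fin (d + 1) → ℝ} (h : 0 < B.conformal s) :
    DifferentiableAt ℝ B.phi s := by
  have h1 : DifferentiableAt ℝ (B.conformal (d := d)) s := by
    unfold conformal
    fun_prop
  exact (h1.log h.ne').const_mul _

lemma fderiv_phi {B : RouthSphere} {s : Fin (d + 1) → ℝ} (h : 0 < B.conformal s)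
    (w : Fin (d + 1) → ℝ) :
    fderiv ℝ B.phi s w = -(B.halfDeriv s / B.conformal s) * w (Fin.last d) := by
  have hc : HasDerivAt (fun ε : ℝ => s + ε • w) w 0 := by
    simpa using ((hasDerivAt_id (0 : ℝ)).smul_const w).const_add s
  have h0 : s + (0 : ℝ) • w = s := by simp
  have h1 : HasDerivAt (fun ε : ℝ => B.phi (s + ε • w)) (fderiv ℝ B.phi s w) 0 := by
    have h' : DifferentiableAt ℝ B.phi (s + (0 : ℝ) • w) := by
      rw [h0]
      exact differentiableAt_phi h
    have := h'.hasFDerivAt.comp_hasDerivAt (0 : ℝ) hc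
    rwa [h0] at this
  have h2 := ((hasDerivAt_conformal B hc).log (by rw [h0]; exact h.ne')).const_mul (-(1 / 2))
  rw [h0] at h2
  rw [h1.unique h2]
  field_simp

theorem isSimple_phi {B : RouthSphere} (hJ₁ : 0 < B.J₁) (hJₙ : 0 < B.Jₙ) (hm : 0 < B.m) :
    IsSimple (d := d) B B.phi := by
  rintro Y Z hY hZ s hs q hq rfl
  have hpos := conformal_pos hJ₁ hJₙ hm hs
  have hYs := hY.tangent _ hs
  have hZs := hZ.tangent _ hs
  set γ := poisson q with hγ
  set b := VectorField.lieBracket ℝ Y Z γ with hb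
  have hbs : γ ⬝ᵥ b = 0 := hY.lieBracket_tangent hZ hs
  set u := fderiv ℝ B.phi γ (Z γ) • Y γ - fderiv ℝ B.phi γ (Y γ) • Z γ with hu
  have hus : γ ⬝ᵥ u = 0 := by
    simp only [hu, dotProduct_sub, dotProduct_smul, hYs, hZs, smul_zero, sub_zero]
  have hubs : γ ⬝ᵥ (u + b) = 0 := by rw [dotProduct_add, hus, hbs, add_zero]
  -- Here `b` is the bracket `[Y, Z]`, not the radius. The projection must lie over `u + b`, and
  -- what remains is that `R (Y ∧ Z)` minus `hor u` is orthogonal to `D`.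
  refine ⟨B.hor q (u + b), ⟨((mem_distribution_iff_eq_hor hq hubs _).2 rfl).1, fun δ hδ => ?_⟩, ?_⟩
  · have hv := poisson_dotProduct_tangentPoisson hq hδ
    set v := tangentPoisson δ with hvdef
    have hδv : δ = B.hor q v := (mem_distribution_iff_eq_hor hq hv δ).1 ⟨hδ, rfl⟩
    have hX : VectorField.lieBracket ℝ (B.horField Y) (B.horField Z) q - B.hor q (u + b) =
        (q.1 * (wedge (Y γ) (Z γ) - wedge γ u), q.1 *ᵥ (0 - -B.b • u)) := by
      rw [lieBracket_horField hY hZ hq]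
      simp only [hor, ← hγ, ← hb]
      ext1
      · simp only [Prod.fst_sub, Prod.fst_add, wedge_add_right, Matrix.mul_add, Matrix.mul_sub]
        abel
      · simp only [Prod.snd_sub, Prod.snd_add, Matrix.mulVec_add, Matrix.mulVec_sub,
          Matrix.mulVec_smul, Matrix.mulVec_zero, smul_add]
        abel
    rw [hX, hδv, metric_eq_bodyForm, transpose_mulVec_hor_snd hq]
    change B.bodyForm _ _ (bodyVelocity q (B.hor q v)) _ = 0
    rw [bodyVelocity_hor hq, ← Matrix.mul_assoc, Matrix.mulVec_mulVec,
      transpose_mul_self_of_mem hq, Matrix.one_mul, Matrix.one_mulVec, bodyForm_sub_left,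
      bodyForm_wedge_tangent B hYs hZs, ← metricS_eq_bodyForm, metricS_tangent B hs hus hv]
    have hu' : u = (-(B.halfDeriv γ / B.conformal γ)) •
        (Z γ (Fin.last d) • Y γ - Y γ (Fin.last d) • Z γ) := by
      rw [hu, fderiv_phi hpos, fderiv_phi hpos, smul_sub, smul_smul, smul_smul]
    -- This removes the `v_n w_n` term of the shape metric, leaving the factor `f` that cancels the
    -- denominator of `u`.
    have hun : u (Fin.last d) = 0 := by
      rw [hu']
      simp only [Pi.smul_apply, Pi.sub_apply, smul_eq_mul]
      ring
    rw [hun, hu', smul_dotProduct, smul_eq_mul]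
    field_simp
    ring
  · rw [tangentPoisson_hor hq hubs, add_sub_cancel_right]

end

/-! ### Solutions of the reduced equations -/

/-- A vector tangent to the sphere at `s` is the value of a field on the sphere. -/
lemma exists_isSphereField {s : Fin (d + 1) → ℝ} (hs : s ⬝ᵥ s = 1) {v : Fin (d + 1) → ℝ}
    (hv : s ⬝ᵥ v = 0) : ∃ Y, IsSphereField Y ∧ Y s = v := by
  -- On the sphere this is the tangential projection of `v`; the factor `x · x` makes it orthogonal
  -- to `x` everywhere, and it is polynomial.
  refine ⟨fun x => (x ⬝ᵥ x) • v - (x ⬝ᵥ v) • x, ⟨?_, fun x hx => ?_⟩, by simp [hs, hv]⟩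
  · simp only [dotProduct]
    fun_prop
  · simp [dotProduct_sub, hx]

/-- For `Y = δ` horizontal and `Z = γ̇`, `Y[φ] = 0`, so the gyroscopic tensor is `Z[φ] δ` and the
right-hand side is `h γ̇_n γ̇ · δ`, half of the second term on the left. -/
lemma IsReducedSolution.equation_horizontal {B : RouthSphere} (hJ₁ : 0 < B.J₁) (hJₙ : 0 < B.Jₙ)
    (hm : 0 < B.m) {I : Set ℝ} (hI : IsOpen I) {γ : ℝ → Fin (d + 1) → ℝ}
    (hγ : B.IsReducedSolution I γ) {t : ℝ} (ht : t ∈ I) {δ : Fin (d + 1) → ℝ}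
    (hδ : γ t ⬝ᵥ δ = 0) (hδn : δ (Fin.last d) = 0) :
    B.conformal (γ t) * (deriv (deriv γ) t ⬝ᵥ δ) +
      B.halfDeriv (γ t) * deriv γ t (Fin.last d) * (deriv γ t ⬝ᵥ δ) = 0 := by
  have hs := hγ.mem_sphere t ht
  have hv := dotProduct_deriv_eq_zero hI hγ.mem_sphere ht
    (hasDerivAt_of_contDiffOn_two hI hγ.contDiffOn ht).1
  have hpos := conformal_pos hJ₁ hJₙ hm hs
  obtain ⟨Y, hY, rfl⟩ := exists_isSphereField hs hδ
  obtain ⟨Z, hZ, hZγ⟩ := exists_isSphereField hs hv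
  have h := hγ.equation t ht Y Z hY hZ hZγ _ (isSimple_phi hJ₁ hJₙ hm Y Z hY hZ _ hs)
  rw [eulerLagrange_reducedLagrangian B hI hγ.contDiffOn hγ.mem_sphere ht hδ hδn, fderiv_phi hpos,
    fderiv_phi hpos, hδn, hZγ, mul_zero, zero_smul, sub_zero,
    metricS_tangent B hs (by rw [dotProduct_smul, hδ, smul_zero]) hv, Pi.smul_apply, hδn, smul_zero,
    zero_mul, mul_zero, add_zero, smul_dotProduct, smul_eq_mul, dotProduct_comm (Y (γ t))] at h
  field_simp at h
  linarith

/-! ### The action of `SO(n-1)` and the momentum map -/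

lemma embed_mulVec_castSucc (a : Matrix (Fin d) (Fin d) ℝ) (γ : Fin (d + 1) → ℝ) (i : Fin d) :
    (embed a *ᵥ γ) i.castSucc = (a *ᵥ fun k => γ k.castSucc) i := by
  simp [Matrix.mulVec, dotProduct, embed, Fin.sum_univ_castSucc]

lemma embed_mulVec_last (a : Matrix (Fin d) (Fin d) ℝ) (γ : Fin (d + 1) → ℝ) :
    (embed a *ᵥ γ) (Fin.last d) = γ (Fin.last d) := by
  simp [Matrix.mulVec, dotProduct, embed, Fin.sum_univ_castSucc]

lemma embed_mulVec_dotProduct {a : Matrix (Fin d) (Fin d) ℝ} (ha : aᵀ * a = 1)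
    (v w : Fin (d + 1) → ℝ) : (embed a *ᵥ v) ⬝ᵥ (embed a *ᵥ w) = v ⬝ᵥ w := by
  have h : ∀ v w : Fin d → ℝ, (a *ᵥ v) ⬝ᵥ (a *ᵥ w) = v ⬝ᵥ w := fun v w => by
    rw [Matrix.dotProduct_mulVec, ← Matrix.mulVec_transpose, Matrix.mulVec_mulVec, ha,
      Matrix.one_mulVec]
  have h' := h (fun k => v k.castSucc) (fun k => w k.castSucc)
  simp only [dotProduct] at h'
  simp only [dotProduct, Fin.sum_univ_castSucc, embed_mulVec_castSucc, embed_mulVec_last, h']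

lemma conformal_embed_mulVec (B : RouthSphere) (a : Matrix (Fin d) (Fin d) ℝ)
    (γ : Fin (d + 1) → ℝ) : B.conformal (embed a *ᵥ γ) = B.conformal γ := by
  simp only [conformal, embed_mulVec_last]

/-- On tangent vectors the Lagrangian involves only dot products and last coordinates, both of which
the action preserves. -/
lemma reducedLagrangian_embed_mulVec (B : RouthSphere) {a : Matrix (Fin d) (Fin d) ℝ}
    (ha : aᵀ * a = 1) {γ v : Fin (d + 1) → ℝ} (h : γ ⬝ᵥ γ = 1) (hv : γ ⬝ᵥ v = 0) :
    B.reducedLagrangian (embed a *ᵥ γ) (embed a *ᵥ v) = B.reducedLagrangian γ v := by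
  have h' : (embed a *ᵥ γ) ⬝ᵥ (embed a *ᵥ γ) = 1 := by rw [embed_mulVec_dotProduct ha, h]
  have hv' : (embed a *ᵥ γ) ⬝ᵥ (embed a *ᵥ v) = 0 := by rw [embed_mulVec_dotProduct ha, hv]
  rw [reducedLagrangian, reducedLagrangian, metricS_tangent B h' hv' hv', metricS_tangent B h hv hv,
    conformal_embed_mulVec, embed_mulVec_dotProduct ha, embed_mulVec_last, embed_mulVec_last]

section

attribute [local instance] Matrix.linftyOpNormedRing Matrix.linftyOpNormedAlgebra

lemma hasDerivAt_exp_smul_apply (ξ : Matrix (Fin d) (Fin d) ℝ) (i j : Fin d) :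
    HasDerivAt (fun t : ℝ => NormedSpace.exp (t • ξ) i j) (ξ i j) 0 := by
  have h : HasDerivAt (fun t : ℝ => NormedSpace.exp (t • ξ)) ξ 0 :=
    (hasDerivAt_exp_smul_const ξ (0 : ℝ)).congr_deriv (by simp)
  exact hasDerivAt_pi.1 (hasDerivAt_pi.1 h i) j

end

lemma generator_eq (ξ : Matrix (Fin d) (Fin d) ℝ) (γ : Fin (d + 1) → ℝ) :
    generator ξ γ =
      Fin.lastCases (motive := fun _ => ℝ) 0 fun i => (ξ *ᵥ fun k => γ k.castSucc) i := by
  refine HasDerivAt.deriv (hasDerivAt_pi.2 fun k => Fin.lastCases ?_ (fun k => ?_) k)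
  · simpa [embed_mulVec_last] using hasDerivAt_const (0 : ℝ) (γ (Fin.last d))
  · simp only [embed_mulVec_castSucc, Fin.lastCases_castSucc]
    simp only [Matrix.mulVec, dotProduct]
    exact HasDerivAt.fun_sum fun l _ => (hasDerivAt_exp_smul_apply ξ k l).mul_const _

lemma generator_wedge (i j : Fin d) (γ : Fin (d + 1) → ℝ) :
    generator (wedge (Pi.single i 1) (Pi.single j 1)) γ = rotation i j γ := by
  ext k
  refine Fin.lastCases ?_ (fun k => ?_) k
  · rw [generator_eq, Fin.lastCases_last, rotation_last]
  · rw [generator_eq, Fin.lastCases_castSucc, wedge_mulVec]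
    simp [rotation, Pi.single_apply]

/-- The generator is horizontal, so the metric reduces to `f v · w`, and `e^φ = 1 / √f` turns `f`
into `√f`. The sign comes from `dotProduct_rotation`. -/
lemma momentumMap_wedge {B : RouthSphere} (hJ₁ : 0 < B.J₁) (hJₙ : 0 < B.Jₙ) (hm : 0 < B.m)
    (i j : Fin d) {γ v : Fin (d + 1) → ℝ} (h : γ ⬝ᵥ γ = 1) (hv : γ ⬝ᵥ v = 0) :
    B.momentumMap γ v (wedge (Pi.single i 1) (Pi.single j 1)) =
      -B.firstIntegral i j γ (wedge γ v) := by
  have hpos := conformal_pos hJ₁ hJₙ hm h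
  have hexp : Real.exp (B.phi γ) * B.conformal γ = √(B.conformal γ) := by
    have h1 : B.phi γ = -Real.log √(B.conformal γ) := by
      rw [phi, Real.log_sqrt hpos.le]
      ring
    rw [h1, Real.exp_neg, Real.exp_log (Real.sqrt_pos.2 hpos), inv_mul_eq_div, Real.div_sqrt]
  rw [momentumMap, generator_wedge, metricS_tangent B h hv (dotProduct_rotation_self i j γ),
    rotation_last, mul_zero, mul_zero, add_zero, dotProduct_rotation, ← mul_assoc, hexp,
    firstIntegral, mul_neg]

end RouthSphere

theorem mainTheorem4 (d : ℕ) (B : RouthSphere) (hJ₁ : 0 < B.J₁) (hJₙ : 0 < B.Jₙ) (hm : 0 < B.m)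
    (hb : 0 < B.b) :
    -- the functions `F_ij` are first integrals of the reduced motion, as functions of `(γ, γ̇)`
    (∀ (I : Set ℝ) (γ : ℝ → Fin (d + 1) → ℝ), IsOpen I → I.OrdConnected →
      B.IsReducedMotion I γ ∨ B.IsReducedSolution I γ →
      ∀ i j : Fin d, ∀ t₁ ∈ I, ∀ t₂ ∈ I,
        B.firstIntegral i j (γ t₁) (RouthSphere.wedge (γ t₁) (deriv γ t₁)) =
          B.firstIntegral i j (γ t₂) (RouthSphere.wedge (γ t₂) (deriv γ t₂))) ∧
    -- the same in terms of the body angular velocity `Ω` along the motions of the sphere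
    (∀ (I : Set ℝ) (c : ℝ → RouthSphere.Ambient d), IsOpen I → I.OrdConnected → B.IsMotion I c →
      ∀ i j : Fin d, ∀ t₁ ∈ I, ∀ t₂ ∈ I,
        B.firstIntegral i j (RouthSphere.poisson (c t₁))
            (RouthSphere.bodyVelocity (c t₁) (deriv c t₁)) =
          B.firstIntegral i j (RouthSphere.poisson (c t₂))
            (RouthSphere.bodyVelocity (c t₂) (deriv c t₂))) ∧
    -- the system is `φ`-simple
    RouthSphere.IsSimple (d := d) B B.phi ∧
    -- the action of `SO(n-1)` on `Sⁿ⁻¹` leaves `φ` and the reduced Lagrangian invariant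
    (∀ a ∈ Matrix.specialOrthogonalGroup (Fin d) ℝ, ∀ γ v : Fin (d + 1) → ℝ,
      γ ⬝ᵥ γ = 1 → γ ⬝ᵥ v = 0 →
      B.phi (RouthSphere.embed a *ᵥ γ) = B.phi γ ∧
      B.reducedLagrangian (RouthSphere.embed a *ᵥ γ) (RouthSphere.embed a *ᵥ v) =
        B.reducedLagrangian γ v) ∧
    -- `F_ij` is, up to sign, the component along `E_i ∧ E_j` of the rescaled momentum map
    (∀ (i j : Fin d) (γ v : Fin (d + 1) → ℝ), γ ⬝ᵥ γ = 1 → γ ⬝ᵥ v = 0 →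
      B.momentumMap γ v (RouthSphere.wedge (Pi.single i 1) (Pi.single j 1)) =
        -B.firstIntegral i j γ (RouthSphere.wedge γ v)) := by
  refine ⟨fun I γ hI hI' h i j t₁ h₁ t₂ h₂ => ?_, fun I c hI hI' hc i j t₁ h₁ t₂ h₂ =>
    hc.firstIntegral_eq hJ₁ hJₙ hm hI hI' i j h₁ h₂, RouthSphere.isSimple_phi hJ₁ hJₙ hm,
    fun a ha γ v h hv => ⟨?_, ?_⟩,
    fun i j γ v h hv => RouthSphere.momentumMap_wedge hJ₁ hJₙ hm i j h hv⟩
  · rcases h with h | h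
    · exact h.firstIntegral_eq hJ₁ hJₙ hm hI hI' i j h₁ h₂
    · exact RouthSphere.firstIntegral_eq_of_equation hJ₁ hJₙ hm hI hI' h.contDiffOn h.mem_sphere
        (fun t ht δ hδ hδn => h.equation_horizontal hJ₁ hJₙ hm hI ht hδ hδn) i j h₁ h₂
  · rw [RouthSphere.phi, RouthSphere.phi, RouthSphere.conformal_embed_mulVec]
  · have ha' : aᵀ * a = 1 := by
      simpa [Matrix.star_eq_conjTranspose] using (Matrix.mem_orthogonalGroup_iff' (Fin d) ℝ).1
        (Matrix.mem_specialOrthogonalGroup_iff.1 ha).1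
    exact RouthSphere.reducedLagrangian_embed_mulVec B ha' h hv
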